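/- Let $\ell$ be an odd prime and let $G$ be a subgroup of $\mathrm{GL}_2(\mathbb F_\ell)$. Write $\overline{G}$ for the image of $G$ in $\mathrm{PGL}_2(\mathbb F_\ell)=\mathrm{GL}_2(\mathbb F_\ell)/\{\text{scalars}\}$, write $\mathrm{PSL}_2(\mathbb F_\ell)\subseteq \mathrm{PGL}_2(\mathbb F_\ell)$ for the image of $\mathrm{SL}_2(\mathbb F_\ell)$, and let $$\mathcal F(G)=\frac{|\{\gamma\in G:\gamma\text{ has an eigenvalue in }\mathbb F_\ell\}|}{|G|}.$$ Fix a non-square $\varepsilon\in\mathbb F_\ell^\times$ and consider the following subgroups of $\mathrm{GL}_2(\mathbb F_\ell)$: the group $\mathcal B$ of invertible upper triangular matrices; the group $\mathcal C_s$ of invertible diagonal matrices; $\mathcal C_s^+=\mathcal C_s\cup\begin{pmatrix}0&1\\1&0\end{pmatrix}\mathcal C_s$; $\mathcal C_{ns}=\left\{\begin{pmatrix}a&\varepsilon b\\b&a\end{pmatrix}:(a,b)\ne(0,0)\right\}$; and $\mathcal C_{ns}^+=\mathcal C_{ns}\cup\begin{pmatrix}1&0\\0&-1\end{pmatrix}\mathcal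 C_{ns}$. Below, "conjugate" means conjugate in $\mathrm{GL}_2(\mathbb F_\ell)$. If $\ell\nmid|G|$, say that $G$ is of type - Cs if $G$ is conjugate to a subgroup of $\mathcal C_s$; - Cn if $G$ is conjugate to a subgroup of $\mathcal C_{ns}$, but not of $\mathcal C_s$; - Ns if $G$ is conjugate to a subgroup of $\mathcal C_s^+$, but not of $\mathcal C_s$ or $\mathcal C_{ns}$; - Nn if $G$ is conjugate to a subgroup of $\mathcal C_{ns}^+$, but not of $\mathcal C_s^+$ or $\mathcal C_{ns}$; - A4, S4 or A5 if $\overline G$ is isomorphic to the alternating group $A_4$, the symmetric group $S_4$ or the alternating group $A_5$, respectively. If $\ell\mid|G|$, say that $G$ is of type - B if $G$ is conjugate to a subgroup of $\mathcal B$, but not of $\mathcal C_s$; - PSL if $\overline G=\mathrm{PSL}_2(\mathbb F_\ell)$; - PGL if $\overline G=\mathrm{PGL}_2(\mathbb F_\ell)$. Then the following hold. 1. $\mathcal F(G)=1$ if $G$ is of type Cs or B; $\mathcal F(G)=\frac1{|\overline G|}$ if $G$ is of type Cn; $\mathcal F(G)=\frac{\ell+3}{2(\ell+1)}$ if $G$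 is of type PSL; and $\mathcal F(G)=\frac{\ell+2}{2(\ell+1)}$ if $G$ is of type PGL. 2. $\mathcal F(G)$ belongs to - $\left\{\frac12,\frac34,1\right\}$ if $G$ is of type Ns; - $\left\{\frac1{|\overline G|},\ \frac14+\frac1{|\overline G|},\ \frac12+\frac1{|\overline G|}\right\}$ if $G$ is of type Nn; - $\left\{\frac1{12},\frac13,\frac34,1\right\}$ if $G$ is of type A4; - $\left\{\frac1{24},\frac7{24},\frac38,\frac5{12},\frac58,\frac23,\frac34,1\right\}$ if $G$ is of type S4; - $\left\{\frac1{60},\frac4{15},\frac7{20},\frac5{12},\frac35,\frac23,\frac34,1\right\}$ if $G$ is of type A5. 3. If $G$ is of type Cn, Nn, PSL or PGL, then $\mathcal F(G)\le\frac34$. 4. For every subgroup $G\subseteq\mathrm{GL}_2(\mathbb F_\ell)$: if $\mathcal F(G)\ne1$, then $\mathcal F(G)\le\frac34$. -/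

import Mathlib

namespace EigenProportion

/-- The group `GL₂(𝔽_ℓ)`. -/
abbrev GL2 (ℓ : ℕ) : Type := Matrix.GeneralLinearGroup (Fin 2) (ZMod ℓ)

/-- The group `PGL₂(𝔽_ℓ)`, the quotient of `GL₂(𝔽_ℓ)` by its center. -/
abbrev PGL2 (ℓ : ℕ) : Type := Matrix.ProjGenLinGroup (Fin 2) (ZMod ℓ)

/-- `PSL₂(𝔽_ℓ)` as a subgroup of `PGL₂(𝔽_ℓ)`: the image of `SL₂(𝔽_ℓ)`. -/
def PSL2 (ℓ : ℕ) : Subgroup (PGL2 ℓ) :=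
  (Matrix.SpecialLinearGroup.toGL :
    Matrix.SpecialLinearGroup (Fin 2) (ZMod ℓ) →* GL2 ℓ).range.map Matrix.ProjGenLinGroup.mk

/-- The image `Ḡ` of a subgroup `G ⊆ GL₂(𝔽_ℓ)` in `PGL₂(𝔽_ℓ)`. -/
def projImage {ℓ : ℕ} (G : Subgroup (GL2 ℓ)) : Subgroup (PGL2 ℓ) :=
  G.map Matrix.ProjGenLinGroup.mk

/-- The Borel subgroup (as a set): invertible upper triangular matrices. -/
def borel (ℓ : ℕ) : Set (GL2 ℓ) :=
  {γ | ∃ a b d : ZMod ℓ, (γ : Matrix (Fin 2) (Fin 2) (ZMod ℓ)) = !![a, b; 0, d]}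

/-- The split Cartan subgroup (as a set): invertible diagonal matrices. -/
def splitCartan (ℓ : ℕ) : Set (GL2 ℓ) :=
  {γ | ∃ a b : ZMod ℓ, (γ : Matrix (Fin 2) (Fin 2) (ZMod ℓ)) = !![a, 0; 0, b]}

/-- The normalizer of the split Cartan subgroup (as a set): the split Cartan subgroup together
with its translate by `!![0, 1; 1, 0]`. -/
def splitCartanNormalizer (ℓ : ℕ) : Set (GL2 ℓ) :=
  splitCartan ℓ ∪ {γ | ∃ δ ∈ splitCartan ℓ,
    (γ : Matrix (Fin 2) (Fin 2) (ZMod ℓ)) =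
      !![0, 1; 1, 0] * (δ : Matrix (Fin 2) (Fin 2) (ZMod ℓ))}

/-- The non-split Cartan subgroup (as a set) attached to a non-square `ε`. -/
def nonsplitCartan (ℓ : ℕ) (ε : ZMod ℓ) : Set (GL2 ℓ) :=
  {γ | ∃ a b : ZMod ℓ, (γ : Matrix (Fin 2) (Fin 2) (ZMod ℓ)) = !![a, ε * b; b, a]}

/-- The normalizer of the non-split Cartan subgroup (as a set): the non-split Cartan subgroup
together with its translate by `!![1, 0; 0, -1]`. -/
def nonsplitCartanNormalizer (ℓ : ℕ) (ε : ZMod ℓ) : Set (GL2 ℓ) :=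
  nonsplitCartan ℓ ε ∪ {γ | ∃ δ ∈ nonsplitCartan ℓ ε,
    (γ : Matrix (Fin 2) (Fin 2) (ZMod ℓ)) =
      !![1, 0; 0, -1] * (δ : Matrix (Fin 2) (Fin 2) (ZMod ℓ))}

/-- `G` is conjugate in `GL₂(𝔽_ℓ)` to a subgroup of `H`. -/
def ConjInto {ℓ : ℕ} (G : Subgroup (GL2 ℓ)) (H : Set (GL2 ℓ)) : Prop :=
  ∃ g : GL2 ℓ, ∀ γ ∈ G, g * γ * g⁻¹ ∈ H

/-- The types in Dickson's classification of subgroups of `GL₂(𝔽_ℓ)`. -/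
inductive DicksonType : Type
  | Cs | Cn | Ns | Nn | A4 | S4 | A5 | B | PSL | PGL

/-- `HasType ε G t`: the subgroup `G` of `GL₂(𝔽_ℓ)` has type `t` in Dickson's classification
(where `ε` is the non-square used to write down the non-split Cartan subgroup). The first seven
types are for groups of order prime to `ℓ`, the last three for groups of order divisible by `ℓ`. -/
def HasType {ℓ : ℕ} (ε : ZMod ℓ) (G : Subgroup (GL2 ℓ)) : DicksonType → Prop
  | .Cs => ¬ ℓ ∣ Nat.card G ∧ ConjInto G (splitCartan ℓ)
  | .Cn => ¬ ℓ ∣ Nat.card G ∧ ConjInto G (nonsplitCartan ℓ ε) ∧ ¬ ConjInto G (splitCartan ℓ)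
  | .Ns => ¬ ℓ ∣ Nat.card G ∧ ConjInto G (splitCartanNormalizer ℓ) ∧
      ¬ ConjInto G (splitCartan ℓ) ∧ ¬ ConjInto G (nonsplitCartan ℓ ε)
  | .Nn => ¬ ℓ ∣ Nat.card G ∧ ConjInto G (nonsplitCartanNormalizer ℓ ε) ∧
      ¬ ConjInto G (splitCartanNormalizer ℓ) ∧ ¬ ConjInto G (nonsplitCartan ℓ ε)
  | .A4 => ¬ ℓ ∣ Nat.card G ∧ Nonempty (projImage G ≃* alternatingGroup (Fin 4))
  | .S4 => ¬ ℓ ∣ Nat.card G ∧ Nonempty (projImage G ≃* Equiv.Perm (Fin 4))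
  | .A5 => ¬ ℓ ∣ Nat.card G ∧ Nonempty (projImage G ≃* alternatingGroup (Fin 5))
  | .B => ℓ ∣ Nat.card G ∧ ConjInto G (borel ℓ) ∧ ¬ ConjInto G (splitCartan ℓ)
  | .PSL => ℓ ∣ Nat.card G ∧ projImage G = PSL2 ℓ
  | .PGL => ℓ ∣ Nat.card G ∧ projImage G = ⊤

/-- The set of matrices in `GL₂(𝔽_ℓ)` having some eigenvalue in `𝔽_ℓ`. -/
def eigenSet (ℓ : ℕ) : Set (GL2 ℓ) :=
  {γ | ∃ c : ZMod ℓ, Module.End.HasEigenvalue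
    (Matrix.toLin' (γ : Matrix (Fin 2) (Fin 2) (ZMod ℓ))) c}

/-- The proportion `F(G)` of elements of `G` that have some eigenvalue in `𝔽_ℓ`. -/
noncomputable def eigenProportion {ℓ : ℕ} (G : Subgroup (GL2 ℓ)) : ℚ :=
  (Nat.card ↥((G : Set (GL2 ℓ)) ∩ eigenSet ℓ) : ℚ) / (Nat.card G : ℚ)

end EigenProportion

open EigenProportion

/-!
Whether a matrix has an eigenvalue depends only on its image in `PGL₂`, so the proportion depends
only on the image of `G` there. A Cartan subgroup is the centralizer of a traceless matrix `D`, and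
it is split or nonsplit according to whether `-det D` is a square. Its normalizer consists of the
`γ` that conjugate `D` to `±D`. Those commuting with `D` are combinations of `1` and `D`: they all
have an eigenvalue in the split case, and only the scalars do in the nonsplit case. Those
anticommuting with `D` are traceless, hence have an eigenvalue exactly if `-det γ` is a square. The
sign and the square class of the determinant form a homomorphism from `G` to a group of order four,
one fiber of which is counted; this gives the values for the types `Cs`, `Cn`, `Ns` and `Nn`.

On an exceptional image the property of having an eigenvalue is a union of conjugacy classes, and
it is unchanged by squaring as long as the square is not scalar, since `A ^ 2` is a combination of
`1` and `A`. For full images of `SL₂` and `GL₂`, matrices without eigenvalue are counted through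
the pairs (trace, determinant) whose discriminant is not a square.

For the bound `3 / 4`, an element of `G` without eigenvalue lies in a nonsplit Cartan subgroup `C`.
At least half of `C ∩ G` has no eigenvalue, conjugates of these elements under different cosets of
the normalizer of `C` are disjoint, and `C` has index at most two in its normalizer. So at least a
quarter of `G` has no eigenvalue.
-/

namespace EigenProportion

/-- The proportion of the elements of a finite type `α` that satisfy `p`; it is `0` if `α` is
empty or infinite. -/
noncomputable def proportion {α : Type*} (p : α → Prop) : ℚ :=
  Nat.card {a // p a} / Nat.card α

section Proportion

variable {α : Type*} {p : α → Prop}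

lemma proportion_congr {q : α → Prop} (h : ∀ a, p a ↔ q a) : proportion p = proportion q := by
  rw [funext fun a => propext (h a)]

lemma proportion_eq_zero (h : ∀ a, ¬ p a) : proportion p = 0 := by
  have : IsEmpty {a // p a} := ⟨fun a => h a a.2⟩
  simp only [proportion, Nat.card_of_isEmpty, Nat.cast_zero, zero_div]

variable [Finite α]

lemma proportion_and_add_proportion_and_not (p q : α → Prop) :
    proportion (fun a => p a ∧ q a) + proportion (fun a => p a ∧ ¬ q a) = proportion p := by
  classical
  have card_split : Nat.card {a // p a ∧ q a} + Nat.card {a // p a ∧ ¬ q a} =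
      Nat.card {a // p a} := by
    rw [← Nat.card_congr (Equiv.sumCompl fun a : {a // p a} => q a), Nat.card_sum,
      Nat.card_congr (Equiv.subtypeSubtypeEquivSubtypeInter p q),
      Nat.card_congr (Equiv.subtypeSubtypeEquivSubtypeInter p (¬ q ·))]
  rw [proportion, proportion, proportion, ← add_div, ← card_split, Nat.cast_add]

variable [Nonempty α]

lemma proportion_eq_one_iff : proportion p = 1 ↔ ∀ a, p a := by
  rw [proportion, div_eq_one_iff_eq (by exact_mod_cast Nat.card_pos.ne'), Nat.cast_inj]
  refine ⟨fun h a => ?_, fun h => Nat.card_congr (Equiv.subtypeUnivEquiv h)⟩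
  by_contra ha
  exact (Finite.card_subtype_lt ha).ne h

lemma proportion_not (p : α → Prop) : proportion (fun a => ¬ p a) = 1 - proportion p := by
  have h := proportion_and_add_proportion_and_not (fun _ : α => True) p
  rw [proportion_eq_one_iff.2 fun _ => trivial] at h
  simp only [true_and] at h
  linarith

end Proportion

section Homomorphism

variable {G H : Type*} [Group G] [Group H] {f : G →* H}

lemma card_comp_of_surjective (hf : Function.Surjective f) (p : H → Prop) :
    Nat.card {g // p (f g)} = Nat.card {h // p h} * Nat.card f.ker := by
  obtain ⟨s, hs⟩ := hf.hasRightInverse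
  rw [← Nat.card_prod]
  exact Nat.card_congr
    { toFun g := (⟨f g, g.2⟩, ⟨(s (f g))⁻¹ * g, by simp [MonoidHom.mem_ker, hs _]⟩)
      invFun x := ⟨s x.1 * x.2, by simpa [MonoidHom.mem_ker.1 x.2.2, hs _] using x.1.2⟩
      left_inv g := by simp
      right_inv x := by ext <;> simp [MonoidHom.mem_ker.1 x.2.2, hs _] }

lemma card_range_ne_one {g : G} (hg : f g ≠ 1) : Nat.card f.range ≠ 1 := fun h =>
  hg (Subgroup.mem_bot.1 (Subgroup.card_eq_one.1 h ▸ ⟨g, rfl⟩))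

variable [Finite G]

lemma proportion_comp_of_surjective (hf : Function.Surjective f) (p : H → Prop) :
    proportion (fun g => p (f g)) = proportion p := by
  have card_eq : Nat.card G = Nat.card H * Nat.card f.ker := by
    rw [← Nat.card_congr (Equiv.subtypeUnivEquiv fun _ => trivial),
      card_comp_of_surjective hf fun _ => True,
      Nat.card_congr (Equiv.subtypeUnivEquiv fun _ => trivial)]
  rw [proportion, proportion, card_comp_of_surjective hf, card_eq, Nat.cast_mul, Nat.cast_mul,
    mul_div_mul_right _ _ (by exact_mod_cast Nat.card_pos.ne')]

lemma proportion_apply_eq (f : G →* H) {y : H} (hy : y ∈ f.range) :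
    proportion (fun g => f g = y) = 1 / Nat.card f.range := by
  have apply_eq_iff (g : G) : f g = y ↔ f.rangeRestrict g = ⟨y, hy⟩ := Subtype.mk_eq_mk.symm
  rw [proportion_congr apply_eq_iff,
    proportion_comp_of_surjective f.rangeRestrict_surjective (· = ⟨y, hy⟩), proportion,
    Nat.card_unique, Nat.cast_one]

lemma proportion_sign_eq_one_of_apply_eq_neg_one {σ : G →* ℤˣ} {g : G} (hg : σ g = -1) :
    proportion (fun g => σ g = 1) = 1 / 2 := by
  have card_dvd : Nat.card σ.range ∣ 2 := by
    simpa only [Nat.card_eq_fintype_card, Fintype.card_units_int] using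
      Subgroup.card_subgroup_dvd_card σ.range
  have card_eq : Nat.card σ.range = 2 := ((Nat.dvd_prime Nat.prime_two).1 card_dvd).resolve_left
    (card_range_ne_one (g := g) (by rw [hg]; decide))
  rw [proportion_apply_eq σ (one_mem _), card_eq, Nat.cast_ofNat]

lemma proportion_apply_eq_mem (hH : Nat.card H = 4) (f : G →* H) {y : H} (hy : y ≠ 1) :
    proportion (fun g => f g = y) ∈ ({0, 1 / 4, 1 / 2} : Set ℚ) := by
  by_cases hmem : y ∈ f.range
  · have card_dvd : Nat.card f.range ∣ 2 ^ 2 :=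
      (Subgroup.card_subgroup_dvd_card f.range).trans hH.dvd
    obtain ⟨g, rfl⟩ := hmem
    have card_ne : Nat.card f.range ≠ 1 := card_range_ne_one hy
    rw [proportion_apply_eq f ⟨g, rfl⟩]
    obtain ⟨k, hk, card_eq⟩ := (Nat.dvd_prime_pow Nat.prime_two).1 card_dvd
    rw [card_eq] at card_ne ⊢
    interval_cases k
    · exact absurd rfl card_ne
    all_goals norm_num
  · exact .inl (proportion_eq_zero fun g hg => hmem ⟨g, hg⟩)

end Homomorphism

open Matrix
open Module.End (HasEigenvalue hasEigenvalue_of_hasEigenvector hasEigenvector_iff mem_eigenspace_iff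
  hasEigenvalue_iff_isRoot_charpoly)

/-- The matrix `A` has an eigenvalue in the field `K` of its entries. -/
def HasRationalEigenvalue {n K : Type*} [Fintype n] [DecidableEq n] [Field K]
    (A : Matrix n n K) : Prop :=
  ∃ c : K, HasEigenvalue (toLin' A) c

section Eigenvalue

variable {n K : Type*} [Fintype n] [DecidableEq n] [Field K] {A B : Matrix n n K}

lemma hasRationalEigenvalue_iff_exists_mulVec :
    HasRationalEigenvalue A ↔ ∃ c : K, ∃ v ≠ 0, A *ᵥ v = c • v := by
  refine exists_congr fun c => ⟨fun h => ?_, ?_⟩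
  · obtain ⟨v, hv⟩ := h.exists_hasEigenvector
    exact ⟨v, hv.2, by simpa only [toLin'_apply] using hv.apply_eq_smul⟩
  · rintro ⟨v, hv, hAv⟩
    exact hasEigenvalue_of_hasEigenvector
      (hasEigenvector_iff.2 ⟨mem_eigenspace_iff.2 (by rw [toLin'_apply, hAv]), hv⟩)

lemma HasRationalEigenvalue.smul_one_add_smul (h : HasRationalEigenvalue B) (a b : K) :
    HasRationalEigenvalue (a • 1 + b • B) := by
  obtain ⟨c, v, hv, hBv⟩ := hasRationalEigenvalue_iff_exists_mulVec.1 h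
  refine hasRationalEigenvalue_iff_exists_mulVec.2 ⟨a + b * c, v, hv, ?_⟩
  rw [add_mulVec, smul_mulVec, smul_mulVec, one_mulVec, hBv, add_smul, mul_smul]

lemma hasRationalEigenvalue_smul_one_add_smul_iff (a : K) {b : K} (hb : b ≠ 0) :
    HasRationalEigenvalue (a • 1 + b • B) ↔ HasRationalEigenvalue B := by
  refine ⟨fun h => ?_, fun h => h.smul_one_add_smul a b⟩
  have := h.smul_one_add_smul (-(b⁻¹ * a)) b⁻¹
  rwa [smul_add, smul_smul, smul_smul, inv_mul_cancel₀ hb, one_smul, neg_smul,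
    neg_add_cancel_left] at this

lemma hasRationalEigenvalue_smul_one [Nonempty n] (a : K) :
    HasRationalEigenvalue (a • (1 : Matrix n n K)) :=
  hasRationalEigenvalue_iff_exists_mulVec.2
    ⟨a, 1, one_ne_zero, by rw [smul_mulVec, one_mulVec]⟩

lemma HasRationalEigenvalue.conj (h : HasRationalEigenvalue A) (g : GL n K) :
    HasRationalEigenvalue (g.1 * A * g⁻¹.1) := by
  obtain ⟨c, v, hv, hAv⟩ := hasRationalEigenvalue_iff_exists_mulVec.1 h
  refine hasRationalEigenvalue_iff_exists_mulVec.2 ⟨c, g.1 *ᵥ v, fun hgv => hv ?_, ?_⟩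
  · rw [← one_mulVec v, ← g.inv_mul, ← mulVec_mulVec, hgv, mulVec_zero]
  · rw [mulVec_mulVec, Units.inv_mul_cancel_right, ← mulVec_mulVec, hAv, mulVec_smul]

lemma hasRationalEigenvalue_conj_iff (g : GL n K) :
    HasRationalEigenvalue (g.1 * A * g⁻¹.1) ↔ HasRationalEigenvalue A := by
  refine ⟨fun h => ?_, fun h => h.conj g⟩
  simpa only [mul_assoc, inv_inv, Units.inv_mul, mul_one, Units.inv_mul_cancel_left]
    using h.conj g⁻¹

end Eigenvalue

section TwoByTwo

variable {K : Type*} [Field K] {A B D : Matrix (Fin 2) (Fin 2) K}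

lemma sq_eq_smul_one_add_smul (A : Matrix (Fin 2) (Fin 2) K) :
    A ^ 2 = (-A.det) • 1 + A.trace • A := by
  have cayley_hamilton := aeval_self_charpoly A
  rw [charpoly_fin_two] at cayley_hamilton
  simp only [map_add, map_sub, map_mul, map_pow, Polynomial.aeval_X, Polynomial.aeval_C,
    Algebra.algebraMap_eq_smul_one, smul_one_mul] at cayley_hamilton
  rw [sub_add, sub_eq_zero] at cayley_hamilton
  rw [cayley_hamilton, neg_smul, neg_add_eq_sub]

lemma mul_self_of_trace_eq_zero (hA : A.trace = 0) : A * A = (-A.det) • 1 := by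
  rw [← sq, sq_eq_smul_one_add_smul, hA, zero_smul, add_zero]

lemma mul_add_mul_of_trace_eq_zero (hA : A.trace = 0) (hB : B.trace = 0) :
    A * B + B * A = (A * B).trace • 1 := by
  rw [trace_fin_two, add_comm, ← eq_neg_iff_add_eq_zero] at hA hB
  ext i j
  fin_cases i <;> fin_cases j <;>
    simp [mul_apply, Fin.sum_univ_two, trace_fin_two, hA, hB] <;> ring

lemma hasRationalEigenvalue_sq_iff (hA : ∀ a : K, A ^ 2 ≠ a • 1) :
    HasRationalEigenvalue (A ^ 2) ↔ HasRationalEigenvalue A := by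
  have trace_ne_zero : A.trace ≠ 0 := fun h =>
    hA (-A.det) (by rw [sq_eq_smul_one_add_smul, h, zero_smul, add_zero])
  rw [sq_eq_smul_one_add_smul, hasRationalEigenvalue_smul_one_add_smul_iff _ trace_ne_zero]

variable [NeZero (2 : K)]

lemma hasRationalEigenvalue_iff_isSquare_discr :
    HasRationalEigenvalue A ↔ IsSquare A.discr := by
  have h2 : (2 : K) ≠ 0 := two_ne_zero
  have hasEigenvalue_iff (c : K) :
      HasEigenvalue (toLin' A) c ↔ c ^ 2 - A.trace * c + A.det = 0 := by
    rw [hasEigenvalue_iff_isRoot_charpoly, charpoly_toLin', charpoly_fin_two]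
    simp
  simp only [HasRationalEigenvalue, hasEigenvalue_iff, discr_fin_two]
  constructor
  · rintro ⟨c, hc⟩
    exact ⟨2 * c - A.trace, by linear_combination (-4) * hc⟩
  · rintro ⟨s, hs⟩
    refine ⟨(A.trace + s) / 2, ?_⟩
    field_simp
    linear_combination -hs

lemma hasRationalEigenvalue_iff_isSquare_neg_det (hA : A.trace = 0) :
    HasRationalEigenvalue A ↔ IsSquare (-A.det) := by
  have discr_eq : A.discr = (-A.det) * 2 ^ 2 := by rw [discr_fin_two, hA]; ring
  rw [hasRationalEigenvalue_iff_isSquare_discr, discr_eq]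
  refine ⟨fun h => ?_, fun h => h.mul (IsSquare.sq 2)⟩
  simpa only [mul_div_cancel_right₀ _ (pow_ne_zero 2 (two_ne_zero (α := K)))]
    using h.div (IsSquare.sq (2 : K))

lemma exists_eq_smul_one_add_smul_of_commute (hD : D.trace = 0) (hD_det : D.det ≠ 0)
    (h : Commute A D) : ∃ a b : K, A = a • 1 + b • D := by
  have h2 : (2 : K) ≠ 0 := two_ne_zero
  set a := A.trace / 2
  set b := (A * D).trace / (-2 * D.det)
  -- `B` is traceless and orthogonal to `D` for the trace form, so it also anticommutes with `D`.
  set B := A - (a • 1 + b • D) with hB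
  have trace_B : B.trace = 0 := by
    simp [hB, hD, a, div_mul_cancel₀ _ h2]
  have trace_B_mul_D : (B * D).trace = 0 := by
    simp only [hB, sub_mul, add_mul, smul_mul_assoc, one_mul, mul_self_of_trace_eq_zero hD,
      trace_sub, trace_add, trace_smul, trace_one, Fintype.card_fin, hD, smul_eq_mul, b]
    field_simp
    ring
  have commute_B : B * D = D * B := (h.sub_left
    (((Commute.one_left D).smul_left a).add_left ((Commute.refl D).smul_left b))).eq
  have B_mul_D : B * D = 0 := by
    have := mul_add_mul_of_trace_eq_zero trace_B hD
    rw [← commute_B, trace_B_mul_D, zero_smul, ← two_smul K] at this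
    exact (smul_eq_zero.1 this).resolve_left h2
  have hD_unit : IsUnit D := (isUnit_iff_isUnit_det D).2 hD_det.isUnit
  exact ⟨a, b, sub_eq_zero.1 (hD_unit.mul_left_eq_zero.1 B_mul_D)⟩

end TwoByTwo

section ProjectiveImage

variable {n K : Type*} [Fintype n] [DecidableEq n] [Field K]

/-- The proportion of the elements of a subgroup `G` of `GL n K` that have an eigenvalue in `K`. -/
noncomputable def eigenvalueProportion (G : Subgroup (GL n K)) : ℚ :=
  proportion fun γ : G => HasRationalEigenvalue γ.1.1

/-- The element `x` of `PGL n K` fixes a point of projective space over `K`; this is expressed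
through a lift of `x` to a matrix, whose eigenvectors in `K ^ n` span the fixed points. -/
def FixesRationalPoint (x : ProjGenLinGroup n K) : Prop :=
  ∃ γ : GL n K, ProjGenLinGroup.mk γ = x ∧ HasRationalEigenvalue γ.1

lemma projMk_eq_one_iff {γ : GL n K} :
    ProjGenLinGroup.mk γ = 1 ↔ ∃ a : K, γ.1 = a • 1 := by
  rw [ProjGenLinGroup.mk_eq_one, GeneralLinearGroup.mem_center_iff_val_mem_range_scalar]
  simp only [Set.mem_range, scalar_apply, smul_one_eq_diagonal, eq_comm]

lemma fixesRationalPoint_mk_iff {γ : GL n K} :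
    FixesRationalPoint (ProjGenLinGroup.mk γ) ↔ HasRationalEigenvalue γ.1 := by
  refine ⟨?_, fun h => ⟨γ, rfl, h⟩⟩
  rintro ⟨δ, hδ, h⟩
  obtain ⟨u, rfl⟩ := ProjGenLinGroup.mk_eq_mk_iff.1 hδ
  have val_eq : (δ * .scalar n u).1 = (0 : K) • 1 + u.1 • δ.1 := by
    simp [← smul_one_eq_diagonal]
  exact val_eq ▸ h.smul_one_add_smul 0 u.1

variable {G : Subgroup (GL n K)} [Finite G]

lemma eigenvalueProportion_eq_proportion_map :
    eigenvalueProportion G =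
      proportion fun x : G.map ProjGenLinGroup.mk => FixesRationalPoint x.1 := by
  rw [← proportion_comp_of_surjective (ProjGenLinGroup.mk.subgroupMap_surjective G)]
  exact proportion_congr fun γ => fixesRationalPoint_mk_iff.symm

lemma eigenvalueProportion_eq_of_map_eq {H : Subgroup (GL n K)} [Finite H]
    (h : G.map ProjGenLinGroup.mk = H.map ProjGenLinGroup.mk) :
    eigenvalueProportion G = eigenvalueProportion H := by
  rw [eigenvalueProportion_eq_proportion_map, eigenvalueProportion_eq_proportion_map, h]

lemma eigenvalueProportion_eq_of_mulEquiv {H : Type*} [Group H]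
    (e : H ≃* G.map ProjGenLinGroup.mk) :
    eigenvalueProportion G = proportion fun h => FixesRationalPoint (e h).1 := by
  have := Finite.of_surjective _ (ProjGenLinGroup.mk.subgroupMap_surjective G)
  have : Finite H := Finite.of_equiv _ e.symm.toEquiv
  rw [eigenvalueProportion_eq_proportion_map]
  exact (proportion_comp_of_surjective (f := e.toMonoidHom) e.surjective _).symm

lemma proportion_scalar :
    proportion (fun γ : G => ∃ a : K, γ.1.1 = a • 1) =
      1 / Nat.card (G.map ProjGenLinGroup.mk) := by
  have range_eq : (ProjGenLinGroup.mk.comp G.subtype).range = G.map ProjGenLinGroup.mk := by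
    rw [MonoidHom.range_comp, Subgroup.range_subtype]
  rw [← range_eq, ← proportion_apply_eq _ (one_mem _)]
  exact proportion_congr fun γ => projMk_eq_one_iff.symm

lemma card_not_hasRationalEigenvalue :
    (Nat.card {γ | γ ∈ G ∧ ¬ HasRationalEigenvalue γ.1} : ℚ) =
      (1 - eigenvalueProportion G) * Nat.card G := by
  rw [eigenvalueProportion, ← proportion_not, proportion,
    div_mul_cancel₀ _ (by exact_mod_cast Nat.card_pos.ne'), Nat.cast_inj]
  exact (Nat.card_congr (Equiv.subtypeSubtypeEquivSubtypeInter (· ∈ G)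
    fun γ => ¬ HasRationalEigenvalue γ.1)).symm

end ProjectiveImage

section Cartan

variable {K : Type*} [Field K] {D : Matrix (Fin 2) (Fin 2) K}

/-- The traceless matrix `D` generates a split Cartan algebra: it has two distinct eigenvalues
`±s` in `K`. -/
structure IsSplit (D : Matrix (Fin 2) (Fin 2) K) : Prop where
  trace_eq_zero : D.trace = 0
  det_ne_zero : D.det ≠ 0
  isSquare_neg_det : IsSquare (-D.det)

/-- The traceless matrix `D` generates a nonsplit Cartan algebra: it has no eigenvalue in `K`. -/
structure IsNonsplit (D : Matrix (Fin 2) (Fin 2) K) : Prop where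
  trace_eq_zero : D.trace = 0
  not_isSquare_neg_det : ¬ IsSquare (-D.det)

lemma IsNonsplit.det_ne_zero (hD : IsNonsplit D) : D.det ≠ 0 := fun h =>
  hD.not_isSquare_neg_det (by rw [h, neg_zero]; exact IsSquare.zero)

lemma IsSplit.ne_zero (hD : IsSplit D) : D ≠ 0 := fun h =>
  hD.det_ne_zero (h ▸ det_zero)

lemma IsNonsplit.ne_zero (hD : IsNonsplit D) : D ≠ 0 := fun h =>
  hD.det_ne_zero (h ▸ det_zero)

lemma isSplit_diag : IsSplit (!![1, 0; 0, -1] : Matrix (Fin 2) (Fin 2) K) where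
  trace_eq_zero := by simp [trace_fin_two]
  det_ne_zero := by simp [det_fin_two]
  isSquare_neg_det := ⟨1, by simp [det_fin_two]⟩

/-- The centralizer of `D` in `GL₂`. It is a Cartan subgroup, split or nonsplit according to `D`,
when `D` is a traceless invertible matrix. -/
def cartan (D : Matrix (Fin 2) (Fin 2) K) : Subgroup (GL (Fin 2) K) where
  carrier := {γ | Commute γ.1 D}
  mul_mem' := Commute.mul_left
  one_mem' := Commute.one_left D
  inv_mem' := Commute.units_inv_left

lemma mem_cartan {γ : GL (Fin 2) K} : γ ∈ cartan D ↔ Commute γ.1 D :=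
  Iff.rfl

lemma semiconjBy_sign_smul {A B C : Matrix (Fin 2) (Fin 2) K} (h : SemiconjBy A B C) (s : ℤˣ) :
    SemiconjBy A (s • B) (s • C) := by
  rw [SemiconjBy, mul_smul_comm, h.eq, smul_mul_assoc]

/-- The matrices that conjugate `D` into `D` or `-D`. If `D` is traceless and invertible, this is
the normalizer of the Cartan subgroup `cartan D`. -/
def cartanNormalizer (D : Matrix (Fin 2) (Fin 2) K) : Subgroup (GL (Fin 2) K) where
  carrier := {γ | ∃ s : ℤˣ, SemiconjBy γ.1 D (s • D)}
  mul_mem' := by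
    rintro γ δ ⟨s, hs⟩ ⟨t, ht⟩
    exact ⟨t * s, by rw [mul_smul]; exact (semiconjBy_sign_smul hs t).mul_left ht⟩
  one_mem' := ⟨1, by rw [one_smul]; exact Commute.one_left D⟩
  inv_mem' := by
    rintro γ ⟨s, hs⟩
    refine ⟨s, ?_⟩
    simpa only [smul_smul, Int.units_mul_self, one_smul] using
      semiconjBy_sign_smul hs.units_inv_symm_left s

lemma cartan_le_cartanNormalizer : cartan D ≤ cartanNormalizer D :=
  fun γ hγ => ⟨1, by rw [one_smul]; exact hγ⟩

variable {G : Subgroup (GL (Fin 2) K)}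

lemma proportion_neg_det_isSquare_mem [Finite K] (σ : G →* ℤˣ) :
    proportion (fun γ : G => σ γ = -1 ∧ IsSquare (-γ.1.1.det)) ∈
      ({0, 1 / 4, 1 / 2} : Set ℚ) := by
  classical
  have := Fintype.ofFinite K
  let χ : Kˣ →* ℤˣ := (quadraticChar K).toUnitHom
  have χ_eq_one_iff (u : Kˣ) : χ u = 1 ↔ IsSquare u.1 := by
    rw [Units.ext_iff, MulChar.coe_toUnitHom, Units.val_one,
      quadraticChar_one_iff_isSquare u.ne_zero]
  let Φ : G →* ℤˣ × ℤˣ := σ.prod ((χ.comp GeneralLinearGroup.det).comp G.subtype)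
  have apply_eq_iff (γ : G) : σ γ = -1 ∧ IsSquare (-γ.1.1.det) ↔ Φ γ = (-1, χ (-1)) := by
    have neg_det : -γ.1.1.det = (-1 * GeneralLinearGroup.det γ.1 : Kˣ) := by simp
    rw [Prod.ext_iff, neg_det, ← χ_eq_one_iff, map_mul, mul_eq_one_iff_inv_eq,
      Int.units_inv_eq_self, eq_comm (a := χ (-1))]
    rfl
  rw [proportion_congr apply_eq_iff]
  refine proportion_apply_eq_mem ?_ Φ ?_
  · rw [Nat.card_prod, Nat.card_eq_fintype_card, Fintype.card_units_int]
  · simp [Prod.ext_iff]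

variable [NeZero (2 : K)]

lemma sign_eq_of_semiconjBy (hD : D ≠ 0) {γ : GL (Fin 2) K} {s t : ℤˣ}
    (hs : SemiconjBy γ.1 D (s • D)) (ht : SemiconjBy γ.1 D (t • D)) : s = t := by
  have smul_eq : s • D = t • D := γ.isUnit.mul_right_cancel (hs.eq.symm.trans ht.eq)
  have neg_ne : -D ≠ D := fun h => hD <| (smul_eq_zero.1
    ((two_smul K D).trans (neg_eq_iff_add_eq_zero.1 h))).resolve_left two_ne_zero
  rcases Int.units_eq_one_or s with rfl | rfl <;> rcases Int.units_eq_one_or t with rfl | rfl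
  · rfl
  · exact absurd (by simpa using smul_eq.symm) neg_ne
  · exact absurd (by simpa using smul_eq) neg_ne
  · rfl

lemma exists_cartanSign (hD : D ≠ 0) (hG : G ≤ cartanNormalizer D) :
    ∃ σ : G →* ℤˣ, ∀ γ, SemiconjBy γ.1.1 D (σ γ • D) := by
  choose σ hσ using fun γ : G => hG γ.2
  refine ⟨MonoidHom.mk' σ fun γ δ => sign_eq_of_semiconjBy hD (hσ (γ * δ)) ?_, hσ⟩
  rw [mul_comm, mul_smul]
  exact (semiconjBy_sign_smul (hσ γ) (σ δ)).mul_left (hσ δ)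

lemma cartanSign_eq_one_iff (hD : D ≠ 0) {σ : G →* ℤˣ}
    (hσ : ∀ γ, SemiconjBy γ.1.1 D (σ γ • D)) {γ : G} : σ γ = 1 ↔ Commute γ.1.1 D := by
  refine ⟨fun h => ?_, fun h => sign_eq_of_semiconjBy hD (hσ γ) (by rwa [one_smul])⟩
  have := hσ γ
  rwa [h, one_smul] at this

lemma trace_eq_zero_of_semiconjBy_neg {A : Matrix (Fin 2) (Fin 2) K} (hD : D.trace = 0)
    (hD_det : D.det ≠ 0) (h : SemiconjBy A D (-D)) : A.trace = 0 := by
  have trace_smul_eq : (A * (D * D)).trace = -(A * (D * D)).trace := by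
    calc (A * (D * D)).trace = (-D * A * D).trace := by rw [← mul_assoc, h.eq]
      _ = -(A * (D * D)).trace := by rw [neg_mul, neg_mul, trace_neg, mul_assoc, trace_mul_comm,
          mul_assoc]
  have : 2 * (-D.det * A.trace) = 0 := by
    rw [mul_self_of_trace_eq_zero hD, mul_smul_comm, mul_one, trace_smul, smul_eq_mul]
      at trace_smul_eq
    linear_combination trace_smul_eq
  simpa [two_ne_zero, hD_det] using this

lemma IsSplit.hasRationalEigenvalue_of_commute (hD : IsSplit D) {A : Matrix (Fin 2) (Fin 2) K}
    (h : Commute A D) : HasRationalEigenvalue A := by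
  obtain ⟨a, b, rfl⟩ := exists_eq_smul_one_add_smul_of_commute hD.trace_eq_zero hD.det_ne_zero h
  exact ((hasRationalEigenvalue_iff_isSquare_neg_det hD.trace_eq_zero).2
    hD.isSquare_neg_det).smul_one_add_smul a b

lemma IsNonsplit.hasRationalEigenvalue_iff_of_commute (hD : IsNonsplit D)
    {A : Matrix (Fin 2) (Fin 2) K} (h : Commute A D) :
    HasRationalEigenvalue A ↔ ∃ a : K, A = a • 1 := by
  refine ⟨fun hA => ?_, fun ⟨a, ha⟩ => ha ▸ hasRationalEigenvalue_smul_one a⟩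
  obtain ⟨a, b, rfl⟩ := exists_eq_smul_one_add_smul_of_commute hD.trace_eq_zero hD.det_ne_zero h
  obtain rfl : b = 0 := by
    by_contra hb
    rw [hasRationalEigenvalue_smul_one_add_smul_iff a hb,
      hasRationalEigenvalue_iff_isSquare_neg_det hD.trace_eq_zero] at hA
    exact hD.not_isSquare_neg_det hA
  exact ⟨a, by rw [zero_smul, add_zero]⟩

lemma IsSplit.eigenvalueProportion_of_le_cartan [Finite G] (hD : IsSplit D) (hG : G ≤ cartan D) :
    eigenvalueProportion G = 1 :=
  proportion_eq_one_iff.2 fun γ => hD.hasRationalEigenvalue_of_commute (hG γ.2)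

lemma IsNonsplit.eigenvalueProportion_of_le_cartan [Finite G] (hD : IsNonsplit D)
    (hG : G ≤ cartan D) :
    eigenvalueProportion G = 1 / Nat.card (G.map ProjGenLinGroup.mk) := by
  rw [← proportion_scalar]
  exact proportion_congr fun γ => hD.hasRationalEigenvalue_iff_of_commute (hG γ.2)

lemma IsNonsplit.exists_isSplit_of_eigenvalueProportion_eq_one [Finite G] (hD : IsNonsplit D)
    (hG : G ≤ cartanNormalizer D) (h : eigenvalueProportion G = 1) :
    ∃ D' : Matrix (Fin 2) (Fin 2) K, IsSplit D' ∧ G ≤ cartan D' := by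
  have hasEigenvalue (γ : G) : HasRationalEigenvalue γ.1.1 := proportion_eq_one_iff.1 h γ
  obtain ⟨σ, hσ⟩ := exists_cartanSign hD.ne_zero hG
  have scalar_of_sign (γ : G) (hγ : σ γ = 1) : ∃ a : K, γ.1.1 = a • 1 :=
    (hD.hasRationalEigenvalue_iff_of_commute
      ((cartanSign_eq_one_iff hD.ne_zero hσ).1 hγ)).1 (hasEigenvalue γ)
  by_cases hG' : ∃ γ, σ γ = -1
  · obtain ⟨δ, hδ⟩ := hG'
    have trace_δ : δ.1.1.trace = 0 :=
      trace_eq_zero_of_semiconjBy_neg hD.trace_eq_zero hD.det_ne_zero (by simpa [hδ] using hσ δ)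
    refine ⟨δ.1.1, ⟨trace_δ, δ.1.det_ne_zero,
      (hasRationalEigenvalue_iff_isSquare_neg_det trace_δ).1 (hasEigenvalue δ)⟩, fun γ hγ => ?_⟩
    rcases Int.units_eq_one_or (σ ⟨γ, hγ⟩) with hγ' | hγ'
    · obtain ⟨a, ha⟩ := scalar_of_sign _ hγ'
      exact mem_cartan.2 (ha ▸ (Commute.one_left δ.1.1).smul_left a)
    · obtain ⟨a, ha⟩ := scalar_of_sign (⟨γ, hγ⟩ * δ⁻¹) (by rw [map_mul, map_inv, hγ', hδ]; rfl)
      have γ_eq : γ.1 = a • δ.1.1 := by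
        rw [← smul_one_mul, ← ha]
        simp
      exact mem_cartan.2 (γ_eq ▸ (Commute.refl δ.1.1).smul_left a)
  · refine ⟨_, isSplit_diag, fun γ hγ => ?_⟩
    obtain ⟨a, ha⟩ := scalar_of_sign ⟨γ, hγ⟩ <|
      (Int.units_eq_one_or _).resolve_right fun h => hG' ⟨_, h⟩
    exact mem_cartan.2 (ha ▸ (Commute.one_left _).smul_left a)

variable [Finite K]

lemma exists_eigenvalueProportion_eq_add (hD : D.trace = 0) (hD_det : D.det ≠ 0) {σ : G →* ℤˣ}
    (hσ : ∀ γ, SemiconjBy γ.1.1 D (σ γ • D)) :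
    ∃ r ∈ ({0, 1 / 4, 1 / 2} : Set ℚ), eigenvalueProportion G =
      proportion (fun γ : G => HasRationalEigenvalue γ.1.1 ∧ Commute γ.1.1 D) + r := by
  have hD_ne : D ≠ 0 := fun h => hD_det (h ▸ det_zero)
  refine ⟨_, proportion_neg_det_isSquare_mem σ, ?_⟩
  rw [eigenvalueProportion, ← proportion_and_add_proportion_and_not _ fun γ : G => σ γ = 1]
  congr 1
  · exact proportion_congr fun γ => and_congr_right' (cartanSign_eq_one_iff hD_ne hσ)
  · refine proportion_congr fun γ => ?_
    rw [and_comm, ← ne_eq, Int.units_ne_iff_eq_neg]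
    refine and_congr_right fun hγ => hasRationalEigenvalue_iff_isSquare_neg_det ?_
    exact trace_eq_zero_of_semiconjBy_neg hD hD_det (by simpa [hγ] using hσ γ)

lemma IsSplit.eigenvalueProportion_mem_of_le_cartanNormalizer (hD : IsSplit D)
    (hG : G ≤ cartanNormalizer D) :
    eigenvalueProportion G ∈ ({1 / 2, 3 / 4, 1} : Set ℚ) := by
  obtain ⟨σ, hσ⟩ := exists_cartanSign hD.ne_zero hG
  by_cases hG' : ∃ γ, σ γ = -1
  · obtain ⟨γ, hγ⟩ := hG'
    have commute_proportion :
        proportion (fun γ : G => HasRationalEigenvalue γ.1.1 ∧ Commute γ.1.1 D) = 1 / 2 := by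
      rw [← proportion_sign_eq_one_of_apply_eq_neg_one hγ]
      exact proportion_congr fun γ => (and_iff_right_of_imp
        hD.hasRationalEigenvalue_of_commute).trans (cartanSign_eq_one_iff hD.ne_zero hσ).symm
    obtain ⟨r, hr, h⟩ := exists_eigenvalueProportion_eq_add hD.trace_eq_zero hD.det_ne_zero hσ
    rw [h, commute_proportion]
    rcases hr with rfl | rfl | rfl <;> norm_num
  · refine .inr (.inr (hD.eigenvalueProportion_of_le_cartan fun γ hγ => ?_))
    refine (cartanSign_eq_one_iff hD.ne_zero hσ (γ := ⟨γ, hγ⟩)).1 ?_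
    exact (Int.units_eq_one_or _).resolve_right fun h => hG' ⟨_, h⟩

lemma IsNonsplit.eigenvalueProportion_mem_of_le_cartanNormalizer (hD : IsNonsplit D)
    (hG : G ≤ cartanNormalizer D) :
    eigenvalueProportion G ∈ ({1 / (Nat.card (G.map ProjGenLinGroup.mk) : ℚ),
      1 / 4 + 1 / (Nat.card (G.map ProjGenLinGroup.mk) : ℚ),
      1 / 2 + 1 / (Nat.card (G.map ProjGenLinGroup.mk) : ℚ)} : Set ℚ) := by
  obtain ⟨σ, hσ⟩ := exists_cartanSign hD.ne_zero hG
  have scalar_iff (γ : G) : HasRationalEigenvalue γ.1.1 ∧ Commute γ.1.1 D ↔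
      ∃ a : K, γ.1.1 = a • 1 := by
    refine ⟨fun h => (hD.hasRationalEigenvalue_iff_of_commute h.2).1 h.1, fun ⟨a, ha⟩ => ?_⟩
    exact ⟨ha ▸ hasRationalEigenvalue_smul_one a, ha ▸ (Commute.one_left D).smul_left a⟩
  obtain ⟨r, hr, h⟩ := exists_eigenvalueProportion_eq_add hD.trace_eq_zero hD.det_ne_zero hσ
  rw [h, proportion_congr scalar_iff, proportion_scalar]
  rcases hr with rfl | rfl | rfl <;> simp [add_comm]

end Cartan

section QuarterBound

lemma relIndex_mul_card_le {X : Type*} [Group X] {N G : Subgroup X} {S T : Set X} [Finite S]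
    (hS : ∀ g ∈ G, ∀ t ∈ T, g * t * g⁻¹ ∈ S) (hN : ∀ g ∈ G, ∀ t ∈ T, g * t * g⁻¹ ∈ T → g ∈ N) :
    N.relIndex G * Nat.card T ≤ Nat.card S := by
  let f : (G ⧸ N.subgroupOf G) × T → S := fun x =>
    ⟨x.1.out.1 * x.2.1 * x.1.out.1⁻¹, hS _ x.1.out.2 _ x.2.2⟩
  -- Conjugates of `T` by representatives of different cosets of `N` are disjoint.
  have f_injective : Function.Injective f := by
    rintro ⟨p, t⟩ ⟨q, u⟩ h
    have conj_eq : p.out.1 * t.1 * p.out.1⁻¹ = q.out.1 * u.1 * q.out.1⁻¹ :=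
      congrArg Subtype.val h
    obtain rfl : p = q := by
      rw [← p.out_eq, ← q.out_eq]
      refine QuotientGroup.eq.2 (hN _ (p.out⁻¹ * q.out).2 u u.2 ?_)
      have conj_eq' : (p.out⁻¹ * q.out).1 * u * (p.out⁻¹ * q.out).1⁻¹ = t := by
        calc (p.out⁻¹ * q.out).1 * u * (p.out⁻¹ * q.out).1⁻¹
            = p.out.1⁻¹ * (q.out.1 * u * q.out.1⁻¹) * p.out.1 := by simp [mul_assoc]
          _ = t := by rw [← conj_eq]; group
      exact conj_eq' ▸ t.2
    exact Prod.ext rfl (Subtype.ext (mul_left_cancel (mul_right_cancel conj_eq)))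
  rw [Subgroup.relIndex, Subgroup.index, ← Nat.card_prod]
  exact Nat.card_le_card_of_injective f f_injective

variable {K : Type*} [Field K] [NeZero (2 : K)] {D : Matrix (Fin 2) (Fin 2) K}
  {G : Subgroup (GL (Fin 2) K)}

lemma exists_isNonsplit_commute {A : Matrix (Fin 2) (Fin 2) K} (hA : ¬ HasRationalEigenvalue A) :
    ∃ D, IsNonsplit D ∧ Commute A D := by
  have trace_eq_zero : (A - (A.trace / 2) • 1).trace = 0 := by
    simp [div_mul_cancel₀ _ (two_ne_zero (α := K))]
  refine ⟨A - (A.trace / 2) • 1, ⟨trace_eq_zero, fun h => hA ?_⟩,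
    (Commute.refl A).sub_right ((Commute.one_right A).smul_right _)⟩
  rw [← hasRationalEigenvalue_iff_isSquare_neg_det trace_eq_zero] at h
  simpa only [one_smul, add_sub_cancel] using h.smul_one_add_smul (A.trace / 2) 1

lemma mem_cartanNormalizer_of_commute_conj (hD : D.trace = 0) (hD_det : D.det ≠ 0)
    {γ : GL (Fin 2) K} (h : Commute (γ.1 * D * γ⁻¹.1) D) : γ ∈ cartanNormalizer D := by
  obtain ⟨a, c, hac⟩ := exists_eq_smul_one_add_smul_of_commute hD hD_det h
  have ha : a = 0 := by
    have := congrArg trace hac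
    rw [trace_mul_comm, Units.inv_mul_cancel_left] at this
    simpa [hD, two_ne_zero] using this.symm
  rw [ha, zero_smul, zero_add] at hac
  have hc : c ^ 2 = 1 := by
    have := congrArg det hac
    rw [det_units_conj, det_smul, Fintype.card_fin, eq_comm] at this
    exact (mul_eq_right₀ hD_det).1 this
  have γ_mul : γ.1 * D = c • D * γ.1 := by rw [← hac, Units.inv_mul_cancel_right]
  rcases sq_eq_one_iff.1 hc with rfl | rfl
  · exact ⟨1, by rw [SemiconjBy, γ_mul, one_smul, one_smul]⟩
  · exact ⟨-1, by rw [SemiconjBy, γ_mul, neg_smul, Units.neg_smul, one_smul, one_smul]⟩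

lemma mem_cartanNormalizer_of_conj_mem_cartan (hD : D.trace = 0) (hD_det : D.det ≠ 0)
    {γ t : GL (Fin 2) K} (ht : t ∈ cartan D) (hγ : γ * t * γ⁻¹ ∈ cartan D)
    (ht' : ¬ HasRationalEigenvalue t.1) : γ ∈ cartanNormalizer D := by
  obtain ⟨a, b, hab⟩ := exists_eq_smul_one_add_smul_of_commute hD hD_det hγ
  have hb : b ≠ 0 := by
    rintro rfl
    rw [zero_smul, add_zero] at hab
    refine ht' ((hasRationalEigenvalue_conj_iff γ).1 ?_)
    rw [← Units.val_mul, ← Units.val_mul, hab]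
    exact hasRationalEigenvalue_smul_one a
  have D_eq : D = b⁻¹ • ((γ * t * γ⁻¹).1 - a • 1) := by
    rw [hab, add_sub_cancel_left, inv_smul_smul₀ hb]
  have commute_conj : Commute (γ.1 * D * γ⁻¹.1) (γ * t * γ⁻¹).1 := by
    rw [Units.val_mul, Units.val_mul]
    calc γ.1 * D * γ⁻¹.1 * (γ.1 * t.1 * γ⁻¹.1) = γ.1 * (D * t.1) * γ⁻¹.1 := by
          simp only [mul_assoc, Units.inv_mul_cancel_left]
      _ = γ.1 * (t.1 * D) * γ⁻¹.1 := by rw [(mem_cartan.1 ht).eq]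
      _ = γ.1 * t.1 * γ⁻¹.1 * (γ.1 * D * γ⁻¹.1) := by
          simp only [mul_assoc, Units.inv_mul_cancel_left]
  refine mem_cartanNormalizer_of_commute_conj hD hD_det ?_
  conv => arg 2; rw [D_eq]
  exact (commute_conj.sub_right ((Commute.one_right _).smul_right a)).smul_right b⁻¹

lemma relIndex_cartan_le_two (hD : D ≠ 0) (hG : G ≤ cartanNormalizer D) :
    (cartan D).relIndex G ≤ 2 := by
  obtain ⟨σ, hσ⟩ := exists_cartanSign hD hG
  have ker_eq : σ.ker = (cartan D).subgroupOf G := by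
    ext γ
    exact cartanSign_eq_one_iff hD hσ
  rw [Subgroup.relIndex, ← ker_eq, Subgroup.index_ker]
  simpa using Subgroup.card_le_card_group σ.range

lemma card_le_card_inf_cartan_mul (hD : D ≠ 0) :
    Nat.card G ≤ Nat.card (cartan D ⊓ G : Subgroup (GL (Fin 2) K)) *
      (2 * (cartanNormalizer D).relIndex G) := by
  rw [← Subgroup.relIndex_bot_left G,
    ← Subgroup.relIndex_mul_relIndex ⊥ (cartan D ⊓ G) G bot_le inf_le_right,
    Subgroup.relIndex_bot_left, Subgroup.inf_relIndex_right,
    ← inf_eq_left.2 (cartan_le_cartanNormalizer (D := D)), ← Subgroup.relIndex_inf_mul_relIndex]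
  gcongr
  exact relIndex_cartan_le_two hD inf_le_left

lemma IsNonsplit.eigenvalueProportion_le_one_half [Finite G] (hD : IsNonsplit D)
    (hG : G ≤ cartan D) (h : eigenvalueProportion G ≠ 1) : eigenvalueProportion G ≤ 1 / 2 := by
  rw [hD.eigenvalueProportion_of_le_cartan hG] at h ⊢
  have card_ne_zero : Nat.card (G.map ProjGenLinGroup.mk) ≠ 0 := by
    have := Finite.of_surjective _ (ProjGenLinGroup.mk.subgroupMap_surjective G)
    exact Nat.card_pos.ne'
  have two_le : 2 ≤ Nat.card (G.map ProjGenLinGroup.mk) :=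
    (Nat.two_le_iff _).2 ⟨card_ne_zero, fun h1 => h (by rw [h1, Nat.cast_one, div_one])⟩
  exact one_div_le_one_div_of_le two_pos (by exact_mod_cast two_le)

theorem eigenvalueProportion_le_of_ne_one [Finite G] (h : eigenvalueProportion G ≠ 1) :
    eigenvalueProportion G ≤ 3 / 4 := by
  obtain ⟨γ, hγ⟩ := not_forall.1 (mt proportion_eq_one_iff.2 h)
  obtain ⟨D, hD, γ_commute⟩ := exists_isNonsplit_commute hγ
  let H := cartan D ⊓ G
  have : Finite H := Finite.of_injective _ (Subgroup.inclusion_injective inf_le_right)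
  have : Finite {γ | γ ∈ G ∧ ¬ HasRationalEigenvalue γ.1} :=
    (Set.toFinite (G : Set (GL (Fin 2) K))).subset fun _ h => h.1
  have H_le : eigenvalueProportion H ≤ 1 / 2 :=
    hD.eigenvalueProportion_le_one_half inf_le_left fun h =>
      hγ (proportion_eq_one_iff.1 h ⟨γ, γ_commute, γ.2⟩)
  have index_mul_le : (cartanNormalizer D).relIndex G *
      Nat.card {γ | γ ∈ H ∧ ¬ HasRationalEigenvalue γ.1} ≤
      Nat.card {γ | γ ∈ G ∧ ¬ HasRationalEigenvalue γ.1} := by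
    refine relIndex_mul_card_le (fun g hg t ht => ⟨?_, ?_⟩) fun g _ t ht ht' => ?_
    · exact mul_mem (mul_mem hg ht.1.2) (inv_mem hg)
    · exact mt (hasRationalEigenvalue_conj_iff g).1 ht.2
    · exact mem_cartanNormalizer_of_conj_mem_cartan hD.trace_eq_zero hD.det_ne_zero
        ht.1.1 ht'.1.1 ht.2
  have card_G_le := card_le_card_inf_cartan_mul (G := G) hD.ne_zero
  have card_pos : (0 : ℚ) < Nat.card G := by exact_mod_cast Nat.card_pos
  qify [card_not_hasRationalEigenvalue] at index_mul_le card_G_le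
  suffices 1 / 4 * (Nat.card G : ℚ) ≤ (1 - eigenvalueProportion G) * Nat.card G by
    linarith [le_of_mul_le_mul_right this card_pos]
  calc 1 / 4 * (Nat.card G : ℚ)
      ≤ 1 / 4 * (Nat.card H * (2 * (cartanNormalizer D).relIndex G)) := by gcongr
    _ = (cartanNormalizer D).relIndex G * ((1 - 1 / 2) * Nat.card H) := by ring
    _ ≤ (cartanNormalizer D).relIndex G * ((1 - eigenvalueProportion H) * Nat.card H) := by gcongr
    _ ≤ (1 - eigenvalueProportion G) * Nat.card G := index_mul_le

end QuarterBound

section ExceptionalGroups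

open Equiv

/-- The properties of the predicate `FixesRationalPoint` on `PGL₂` that determine its possible
proportions on a finite group: it is invariant under conjugation, and under squaring as long as
the square is not `1`. -/
structure IsFixingLike {H : Type*} [Group H] (E : H → Prop) : Prop where
  one : E 1
  conj_iff : ∀ g h, E (g * h * g⁻¹) ↔ E h
  sq_iff : ∀ h, h ^ 2 ≠ 1 → (E (h ^ 2) ↔ E h)

lemma isFixingLike_fixesRationalPoint {K : Type*} [Field K] :
    IsFixingLike (FixesRationalPoint : ProjGenLinGroup (Fin 2) K → Prop) where
  one := ⟨1, map_one _, by simpa using hasRationalEigenvalue_smul_one (n := Fin 2) (1 : K)⟩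
  conj_iff x y := by
    obtain ⟨γ, rfl⟩ := ProjGenLinGroup.mk_surjective x
    obtain ⟨δ, rfl⟩ := ProjGenLinGroup.mk_surjective y
    rw [← map_inv, ← map_mul, ← map_mul, fixesRationalPoint_mk_iff, fixesRationalPoint_mk_iff]
    exact hasRationalEigenvalue_conj_iff γ
  sq_iff x hx := by
    obtain ⟨γ, rfl⟩ := ProjGenLinGroup.mk_surjective x
    rw [← map_pow, ne_eq, projMk_eq_one_iff, not_exists] at hx
    rw [← map_pow, fixesRationalPoint_mk_iff, fixesRationalPoint_mk_iff]
    exact hasRationalEigenvalue_sq_iff hx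

namespace IsFixingLike

variable {H : Type*} [Group H] {E : H → Prop}

lemma comp_injective (hE : IsFixingLike E) {H' : Type*} [Group H'] {f : H' →* H}
    (hf : Function.Injective f) : IsFixingLike fun h => E (f h) where
  one := by rw [map_one]; exact hE.one
  conj_iff g h := by rw [map_mul, map_mul, map_inv, hE.conj_iff]
  sq_iff h hh := by
    rw [map_pow, hE.sq_iff]
    rwa [← map_pow, ne_eq, map_eq_one_iff f hf]

open Classical in
lemma proportion_eq_sum [Finite H] (hE : IsFixingLike E) {n : ℕ} (c : H → Fin n) (r : Fin n → H)
    (hcr : ∀ h, ∃ g, g * h * g⁻¹ = r (c h) ∨ h ^ 2 ≠ 1 ∧ g * h ^ 2 * g⁻¹ = r (c h)) :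
    proportion E =
      (∑ i, if E (r i) then (Nat.card {h // c h = i} : ℚ) else 0) / Nat.card H := by
  have apply_iff (h : H) : E h ↔ E (r (c h)) := by
    obtain ⟨g, hg | ⟨hne, hg⟩⟩ := hcr h
    · rw [← hg, hE.conj_iff]
    · rw [← hg, hE.conj_iff, hE.sq_iff h hne]
  have := Fintype.ofFinite H
  rw [proportion_congr apply_iff, proportion]
  congr 1
  simp only [Nat.card_eq_fintype_card, Fintype.card_subtype]
  rw [Finset.card_eq_sum_card_fiberwise (f := c) (t := Finset.univ) (by simp)]
  push_cast
  refine Finset.sum_congr rfl fun i _ => ?_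
  rw [Finset.filter_filter]
  by_cases hi : E (r i)
  · rw [if_pos hi, Nat.cast_inj]
    congr 1
    exact Finset.filter_congr fun h _ => and_iff_right_of_imp fun hc => hc ▸ hi
  · rw [if_neg hi, Nat.cast_eq_zero, Finset.card_eq_zero, Finset.filter_eq_empty_iff]
    exact fun h _ ⟨hE', hc⟩ => hi (hc ▸ hE')

lemma proportion_mem_of_alternatingGroup_four {E : alternatingGroup (Fin 4) → Prop}
    (hE : IsFixingLike E) : proportion E ∈ ({1 / 12, 1 / 3, 3 / 4, 1} : Set ℚ) := by
  -- Squaring exchanges the two classes of three-cycles.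
  let c (h : alternatingGroup (Fin 4)) : Fin 3 := if h = 1 then 0 else if h ^ 2 = 1 then 1 else 2
  let r : Fin 3 → alternatingGroup (Fin 4) :=
    ![1, ⟨swap 0 1 * swap 2 3, Perm.mem_alternatingGroup.2 (by decide)⟩,
      ⟨swap 0 1 * swap 1 2, Perm.mem_alternatingGroup.2 (by decide)⟩]
  obtain ⟨card_0, card_1, card_2⟩ :
      Fintype.card {h // c h = 0} = 1 ∧ Fintype.card {h // c h = 1} = 3 ∧
        Fintype.card {h // c h = 2} = 8 := by
    decide +kernel
  rw [hE.proportion_eq_sum c r (by decide +kernel), Fin.sum_univ_three]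
  have card_eq : Fintype.card (alternatingGroup (Fin 4)) = 12 := by decide +kernel
  have one_fixing : E (r 0) := hE.one
  simp only [Nat.card_eq_fintype_card, card_0, card_1, card_2, card_eq, if_pos one_fixing]
  by_cases h1 : E (r 1) <;> by_cases h2 : E (r 2) <;> norm_num [h1, h2]

lemma proportion_mem_of_perm_four {E : Perm (Fin 4) → Prop} (hE : IsFixingLike E) :
    proportion E ∈ ({1 / 24, 7 / 24, 3 / 8, 5 / 12, 5 / 8, 2 / 3, 3 / 4, 1} : Set ℚ) := by
  -- The fiber `c = 1` consists of the double transpositions and the four-cycles, which square to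
  -- double transpositions.
  let c (h : Perm (Fin 4)) : Fin 4 :=
    if h = 1 then 0 else if h ^ 3 = 1 then 3 else if h ^ 2 = 1 ∧ h.sign = -1 then 2 else 1
  let r : Fin 4 → Perm (Fin 4) := ![1, swap 0 1 * swap 2 3, swap 0 1, swap 0 1 * swap 1 2]
  obtain ⟨card_0, card_1, card_2, card_3⟩ :
      Fintype.card {h // c h = 0} = 1 ∧ Fintype.card {h // c h = 1} = 9 ∧
        Fintype.card {h // c h = 2} = 6 ∧ Fintype.card {h // c h = 3} = 8 := by
    decide +kernel
  rw [hE.proportion_eq_sum c r (by decide +kernel), Fin.sum_univ_four]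
  have card_eq : Fintype.card (Perm (Fin 4)) = 24 := by decide +kernel
  have one_fixing : E (r 0) := hE.one
  simp only [Nat.card_eq_fintype_card, card_0, card_1, card_2, card_3, card_eq, if_pos one_fixing]
  by_cases h1 : E (r 1) <;> by_cases h2 : E (r 2) <;> by_cases h3 : E (r 3) <;>
    norm_num [h1, h2, h3]

lemma proportion_mem_of_alternatingGroup_five {E : alternatingGroup (Fin 5) → Prop}
    (hE : IsFixingLike E) :
    proportion E ∈ ({1 / 60, 4 / 15, 7 / 20, 5 / 12, 3 / 5, 2 / 3, 3 / 4, 1} : Set ℚ) := by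
  -- Squaring exchanges the two classes of five-cycles.
  let c (h : alternatingGroup (Fin 5)) : Fin 4 :=
    if h = 1 then 0 else if h ^ 2 = 1 then 1 else if h ^ 3 = 1 then 2 else 3
  let r : Fin 4 → alternatingGroup (Fin 5) :=
    ![1, ⟨swap 0 1 * swap 2 3, Perm.mem_alternatingGroup.2 (by decide)⟩,
      ⟨swap 0 1 * swap 1 2, Perm.mem_alternatingGroup.2 (by decide)⟩,
      ⟨swap 0 1 * swap 1 2 * swap 2 3 * swap 3 4, Perm.mem_alternatingGroup.2 (by decide)⟩]
  obtain ⟨card_0, card_1, card_2, card_3⟩ :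
      Fintype.card {h // c h = 0} = 1 ∧ Fintype.card {h // c h = 1} = 15 ∧
        Fintype.card {h // c h = 2} = 20 ∧ Fintype.card {h // c h = 3} = 24 := by
    decide +kernel
  rw [hE.proportion_eq_sum c r (by decide +kernel), Fin.sum_univ_four]
  have card_eq : Fintype.card (alternatingGroup (Fin 5)) = 60 := by decide +kernel
  have one_fixing : E (r 0) := hE.one
  simp only [Nat.card_eq_fintype_card, card_0, card_1, card_2, card_3, card_eq, if_pos one_fixing]
  by_cases h1 : E (r 1) <;> by_cases h2 : E (r 2) <;> by_cases h3 : E (r 3) <;>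
    norm_num [h1, h2, h3]

end IsFixingLike

lemma exists_isFixingLike_eigenvalueProportion_eq {K : Type*} [Field K]
    {G : Subgroup (GL (Fin 2) K)} [Finite G] {H : Type*} [Group H]
    (e : G.map ProjGenLinGroup.mk ≃* H) :
    ∃ E : H → Prop, IsFixingLike E ∧ eigenvalueProportion G = proportion E :=
  ⟨_, isFixingLike_fixesRationalPoint.comp_injective
    (f := (Subgroup.subtype _).comp e.symm.toMonoidHom)
    (Subtype.val_injective.comp e.symm.injective), eigenvalueProportion_eq_of_mulEquiv e.symm⟩

end ExceptionalGroups

section SpecialAndGeneralLinearGroup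

variable {K : Type*} [Field K]

lemma apply_zero_one_ne_zero {A : Matrix (Fin 2) (Fin 2) K} (hA : ¬ IsSquare A.discr) :
    A 0 1 ≠ 0 := fun h =>
  hA ⟨A 0 0 - A 1 1, by rw [discr_fin_two, trace_fin_two, det_fin_two, h]; ring⟩

lemma mem_range_toGL {γ : GL (Fin 2) K} :
    γ ∈ (SpecialLinearGroup.toGL : SpecialLinearGroup (Fin 2) K →* GL (Fin 2) K).range ↔
      γ.1.det = 1 :=
  ⟨fun ⟨s, hs⟩ => hs ▸ s.2, fun h => ⟨⟨γ.1, h⟩, Units.ext rfl⟩⟩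

lemma card_det_and_not_hasRationalEigenvalue [NeZero (2 : K)] (p : K → Prop) :
    Nat.card {γ : GL (Fin 2) K // p γ.1.det ∧ ¬ HasRationalEigenvalue γ.1} =
      Nat.card K * (Nat.card K - 1) *
        Nat.card {x : K × K // p x.2 ∧ ¬ IsSquare (x.1 ^ 2 - 4 * x.2)} := by
  -- The `(0, 1)` entry of a matrix without eigenvalues is nonzero, so that the matrix is determined
  -- by its first row, its trace and its determinant.
  rw [← Nat.card_units, ← Nat.card_prod, ← Nat.card_prod]
  simp only [hasRationalEigenvalue_iff_isSquare_discr]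
  refine Nat.card_eq_of_bijective (fun γ =>
    ((γ.1.1 0 0, Units.mk0 _ (apply_zero_one_ne_zero γ.2.2)),
      ⟨(γ.1.1.trace, γ.1.1.det), by simpa only [discr_fin_two] using γ.2⟩)) ⟨?_, ?_⟩
  · intro γ δ h
    simp only [Prod.mk.injEq, Subtype.mk.injEq, Units.mk0_inj] at h
    obtain ⟨⟨h00, h01⟩, htrace, hdet⟩ := h
    have h11 : γ.1.1 1 1 = δ.1.1 1 1 := by
      rw [trace_fin_two, trace_fin_two, h00] at htrace
      exact add_left_cancel htrace
    have h10 : γ.1.1 1 0 = δ.1.1 1 0 := by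
      rw [det_fin_two, det_fin_two, h00, h11, h01] at hdet
      exact mul_left_cancel₀ (apply_zero_one_ne_zero δ.2.2) (sub_right_injective hdet)
    refine Subtype.ext (Units.ext ?_)
    rw [eta_fin_two γ.1.1, eta_fin_two δ.1.1, h00, h01, h10, h11]
  · rintro ⟨⟨a, b⟩, ⟨⟨t, d⟩, hp, hsq⟩⟩
    have hb := b.ne_zero
    let A : Matrix (Fin 2) (Fin 2) K := !![a, b; (a * (t - a) - d) / b, t - a]
    have hdet : A.det = d := by
      rw [det_fin_two_of]
      field_simp
      ring
    have htrace : A.trace = t := by rw [trace_fin_two_of, add_sub_cancel]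
    have d_ne_zero : d ≠ 0 := fun h => hsq ⟨t, by simp only [h]; ring⟩
    refine ⟨⟨GeneralLinearGroup.mkOfDetNeZero A (hdet ▸ d_ne_zero), ?_⟩, ?_⟩
    · change p A.det ∧ ¬ IsSquare A.discr
      rw [discr_fin_two, hdet, htrace]
      exact ⟨hp, hsq⟩
    · exact Prod.ext (Prod.ext rfl (Units.ext rfl)) (Subtype.ext (Prod.ext htrace hdet))

variable [Finite K]

lemma card_GL_two : (Nat.card (GL (Fin 2) K) : ℚ) =
    ((Nat.card K : ℚ) ^ 2 - 1) * ((Nat.card K : ℚ) ^ 2 - Nat.card K) := by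
  have := Fintype.ofFinite K
  have one_le_card : 1 ≤ Nat.card K := Nat.card_pos
  rw [card_GL_field, Fin.prod_univ_two, ← Nat.card_eq_fintype_card]
  simp only [Fin.val_zero, Fin.val_one, pow_zero, pow_one]
  rw [Nat.cast_mul, Nat.cast_sub (Nat.one_le_pow _ _ one_le_card),
    Nat.cast_sub (Nat.le_self_pow two_ne_zero _)]
  push_cast
  rfl

lemma card_range_toGL_two : (Nat.card (SpecialLinearGroup.toGL :
    SpecialLinearGroup (Fin 2) K →* GL (Fin 2) K).range : ℚ) =
      ((Nat.card K : ℚ) ^ 2 - 1) * Nat.card K := by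
  have range_eq_ker : (SpecialLinearGroup.toGL :
      SpecialLinearGroup (Fin 2) K →* GL (Fin 2) K).range =
        (GeneralLinearGroup.det : GL (Fin 2) K →* Kˣ).ker :=
    SetLike.coe_injective SpecialLinearGroup.range_toGL
  have one_lt_card : 1 < Nat.card K := Finite.one_lt_card
  have sub_one_ne_zero : (Nat.card K : ℚ) - 1 ≠ 0 :=
    sub_ne_zero.2 (by exact_mod_cast one_lt_card.ne')
  have card_mul_index := (GeneralLinearGroup.det : GL (Fin 2) K →* Kˣ).ker.card_mul_index
  rw [Subgroup.index_ker, MonoidHom.range_eq_top.2 GeneralLinearGroup.det_surjective,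
    Subgroup.card_top, Nat.card_units, ← Nat.cast_inj (R := ℚ), Nat.cast_mul,
    Nat.cast_sub one_lt_card.le, card_GL_two, Nat.cast_one] at card_mul_index
  rw [range_eq_ker]
  exact mul_right_cancel₀ sub_one_ne_zero (by linear_combination card_mul_index)

variable [NeZero (2 : K)]

lemma two_mul_card_not_isSquare {X : Type*} [Finite X] (f : X → K) :
    2 * Nat.card {x // ¬ IsSquare (f x)} + Nat.card {x // f x = 0} +
      Nat.card {p : X × K // p.2 ^ 2 = f p.1} = 2 * Nat.card X := by
  classical
  have := Fintype.ofFinite X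
  have := Fintype.ofFinite K
  have ringChar_ne_two : ringChar K ≠ 2 := fun h =>
    two_ne_zero ((ringChar.spec K 2).2 (dvd_of_eq h))
  have card_fiber (x : X) : 2 * (if ¬ IsSquare (f x) then 1 else 0) +
      (if f x = 0 then 1 else 0) + (Nat.card {s // s ^ 2 = f x} : ℤ) = 2 := by
    have card_sqrt := quadraticChar_card_sqrts ringChar_ne_two (f x)
    rw [Set.toFinset_card, ← Nat.card_eq_fintype_card] at card_sqrt
    change (Nat.card {s // s ^ 2 = f x} : ℤ) = _ at card_sqrt
    rw [card_sqrt]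
    by_cases h0 : f x = 0
    · simp [h0]
    by_cases hs : IsSquare (f x)
    · simp [h0, hs, (quadraticChar_one_iff_isSquare h0).2 hs]
    · simp [h0, hs, quadraticChar_neg_one_iff_not_isSquare.2 hs]
  rw [Nat.card_congr (Equiv.subtypeProdEquivSigmaSubtype fun x s => s ^ 2 = f x), Nat.card_sigma,
    Nat.subtype_card {x | ¬ IsSquare (f x)} (by simp), Nat.subtype_card {x | f x = 0} (by simp),
    Finset.card_filter, Finset.card_filter, Finset.mul_sum, ← Finset.sum_add_distrib,
    ← Finset.sum_add_distrib, Finset.sum_congr rfl fun x _ => by exact_mod_cast card_fiber x,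
    Finset.sum_const, Finset.card_univ, Nat.card_eq_fintype_card, smul_eq_mul, mul_comm]

lemma card_hyperbola :
    Nat.card {p : K × K // p.2 ^ 2 = p.1 ^ 2 - 4} = Nat.card K - 1 := by
  have h2 : (2 : K) ≠ 0 := two_ne_zero
  rw [← Nat.card_units]
  symm
  refine Nat.card_eq_of_bijective (fun u : Kˣ =>
    (⟨(u.1 + u.1⁻¹, u.1 - u.1⁻¹), ?_⟩ : {p : K × K // p.2 ^ 2 = p.1 ^ 2 - 4})) ⟨?_, ?_⟩
  · have := u.ne_zero
    field_simp
    ring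
  · intro u v h
    obtain ⟨h_add, h_sub⟩ := Prod.mk.inj (congrArg Subtype.val h)
    exact Units.ext (mul_left_cancel₀ h2 (by linear_combination h_add + h_sub))
  · rintro ⟨⟨t, s⟩, h : s ^ 2 = t ^ 2 - 4⟩
    have mul_eq_one : (t + s) / 2 * ((t - s) / 2) = 1 := by
      field_simp
      linear_combination -h
    refine ⟨Units.mkOfMulEqOne _ _ mul_eq_one, Subtype.ext ?_⟩
    simp only [Units.val_mkOfMulEqOne, inv_eq_of_mul_eq_one_right mul_eq_one, Prod.mk.injEq]
    constructor <;> field_simp <;> ring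

lemma two_mul_card_not_isSquare_sq_sub_four_mul :
    2 * Nat.card {x : K × K // ¬ IsSquare (x.1 ^ 2 - 4 * x.2)} + Nat.card K = Nat.card K ^ 2 := by
  have h2 : (2 : K) ≠ 0 := two_ne_zero
  have h4 : (4 : K) ≠ 0 := by simpa [show (4 : K) = 2 * 2 by norm_num] using h2
  have card_eq_zero : Nat.card {x : K × K // x.1 ^ 2 - 4 * x.2 = 0} = Nat.card K :=
    Nat.card_congr
      { toFun x := x.1.1
        invFun t := ⟨(t, t ^ 2 / 4), by field_simp; ring⟩
        left_inv x := Subtype.ext (Prod.ext rfl (by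
          rw [div_eq_iff h4]; linear_combination x.2))
        right_inv _ := rfl }
  have card_sqrt :
      Nat.card {p : (K × K) × K // p.2 ^ 2 = p.1.1 ^ 2 - 4 * p.1.2} = Nat.card K ^ 2 := by
    rw [sq, ← Nat.card_prod]
    exact Nat.card_congr
      { toFun p := (p.1.1.1, p.1.2)
        invFun y := ⟨((y.1, (y.1 ^ 2 - y.2 ^ 2) / 4), y.2), by field_simp; ring⟩
        left_inv p := Subtype.ext (Prod.ext (Prod.ext rfl (by
          rw [div_eq_iff h4]; linear_combination -p.2)) rfl)
        right_inv _ := rfl }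
  have := two_mul_card_not_isSquare fun x : K × K => x.1 ^ 2 - 4 * x.2
  rw [card_eq_zero, card_sqrt, Nat.card_prod, ← sq] at this
  omega

lemma two_mul_card_not_isSquare_sq_sub_four :
    2 * Nat.card {t : K // ¬ IsSquare (t ^ 2 - 4)} + 1 = Nat.card K := by
  classical
  have h2 : (2 : K) ≠ 0 := two_ne_zero
  have two_ne_neg_two : (2 : K) ≠ -2 := fun h => mul_ne_zero h2 h2 (by linear_combination h)
  have card_eq_zero : Nat.card {t : K // t ^ 2 - 4 = 0} = 2 := by
    rw [Nat.subtype_card {2, -2}, Finset.card_pair two_ne_neg_two]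
    intro t
    rw [Finset.mem_insert, Finset.mem_singleton, ← sq_eq_sq_iff_eq_or_eq_neg, sub_eq_zero]
    norm_num
  have := two_mul_card_not_isSquare fun t : K => t ^ 2 - 4
  rw [card_eq_zero, card_hyperbola] at this
  have := Nat.card_pos (α := K)
  omega

lemma one_sub_eigenvalueProportion_mul_card {G : Subgroup (GL (Fin 2) K)} {p : K → Prop}
    (hG : ∀ γ : GL (Fin 2) K, γ ∈ G ↔ p γ.1.det) :
    (1 - eigenvalueProportion G) * Nat.card G = Nat.card K * (Nat.card K - 1) *
      Nat.card {x : K × K // p x.2 ∧ ¬ IsSquare (x.1 ^ 2 - 4 * x.2)} := by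
  have one_le_card : 1 ≤ Nat.card K := Nat.card_pos
  rw [← card_not_hasRationalEigenvalue]
  simp only [hG]
  rw [← Nat.cast_one, ← Nat.cast_sub one_le_card, ← Nat.cast_mul, ← Nat.cast_mul, Nat.cast_inj]
  exact card_det_and_not_hasRationalEigenvalue p

lemma eigenvalueProportion_top :
    eigenvalueProportion (⊤ : Subgroup (GL (Fin 2) K)) =
      ((Nat.card K : ℚ) + 2) / (2 * ((Nat.card K : ℚ) + 1)) := by
  have one_lt_card : (1 : ℚ) < Nat.card K := by exact_mod_cast Finite.one_lt_card (α := K)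
  have card_compl := one_sub_eigenvalueProportion_mul_card
    (G := (⊤ : Subgroup (GL (Fin 2) K))) (p := fun _ => True) fun _ => iff_of_true trivial trivial
  have card_nonsquare := congrArg (Nat.cast : ℕ → ℚ)
    (two_mul_card_not_isSquare_sq_sub_four_mul (K := K))
  simp only [true_and, Subgroup.card_top, card_GL_two] at card_compl
  push_cast at card_nonsquare
  generalize (Nat.card K : ℚ) = q at *
  have : q * (q - 1) ^ 2 ≠ 0 := (mul_pos (by linarith) (pow_pos (by linarith) 2)).ne'
  rw [eq_div_iff (by linarith)]
  refine mul_left_cancel₀ this ?_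
  linear_combination (-2) * card_compl - q * (q - 1) * card_nonsquare

lemma eigenvalueProportion_range_toGL :
    eigenvalueProportion (SpecialLinearGroup.toGL :
      SpecialLinearGroup (Fin 2) K →* GL (Fin 2) K).range =
        ((Nat.card K : ℚ) + 3) / (2 * ((Nat.card K : ℚ) + 1)) := by
  have one_lt_card : (1 : ℚ) < Nat.card K := by exact_mod_cast Finite.one_lt_card (α := K)
  have card_compl := one_sub_eigenvalueProportion_mul_card
    (K := K) (p := (· = 1)) fun _ => mem_range_toGL
  have card_eq : Nat.card {x : K × K // x.2 = 1 ∧ ¬ IsSquare (x.1 ^ 2 - 4 * x.2)} =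
      Nat.card {t : K // ¬ IsSquare (t ^ 2 - 4)} :=
    Nat.card_congr
      { toFun x := ⟨x.1.1, by simpa only [x.2.1, mul_one] using x.2.2⟩
        invFun t := ⟨(t, 1), rfl, by simpa only [mul_one] using t.2⟩
        left_inv x := Subtype.ext (Prod.ext rfl x.2.1.symm)
        right_inv _ := rfl }
  have card_nonsquare := congrArg (Nat.cast : ℕ → ℚ)
    (two_mul_card_not_isSquare_sq_sub_four (K := K))
  rw [card_eq, card_range_toGL_two] at card_compl
  push_cast at card_nonsquare
  generalize (Nat.card K : ℚ) = q at *
  have : q * (q - 1) ≠ 0 := (mul_pos (by linarith) (by linarith)).ne'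
  rw [eq_div_iff (by linarith)]
  refine mul_left_cancel₀ this ?_
  linear_combination (-2) * card_compl - q * (q - 1) * card_nonsquare

end SpecialAndGeneralLinearGroup

section Types

variable {K : Type*} [Field K]

/-- The types of subgroups of `GL₂` over a field, without the conditions on the order of the group
and phrased without a choice of coordinates: a conjugate of a diagonal matrix group centralizes
a matrix `D` as in `IsSplit`, and so on. The types exclude each other only as far as this is needed
for the values of `eigenvalueProportion`. -/
def IsOfType (G : Subgroup (GL (Fin 2) K)) : DicksonType → Prop
  | .Cs => ∃ D, IsSplit D ∧ G ≤ cartan D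
  | .Cn => (∃ D, IsNonsplit D ∧ G ≤ cartan D) ∧ ¬ ∃ D, IsSplit D ∧ G ≤ cartan D
  | .Ns => ∃ D, IsSplit D ∧ G ≤ cartanNormalizer D
  | .Nn => (∃ D, IsNonsplit D ∧ G ≤ cartanNormalizer D) ∧ ¬ ∃ D, IsSplit D ∧ G ≤ cartan D
  | .A4 => Nonempty (G.map ProjGenLinGroup.mk ≃* alternatingGroup (Fin 4))
  | .S4 => Nonempty (G.map ProjGenLinGroup.mk ≃* Equiv.Perm (Fin 4))
  | .A5 => Nonempty (G.map ProjGenLinGroup.mk ≃* alternatingGroup (Fin 5))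
  | .B => ∃ v : Fin 2 → K, v ≠ 0 ∧ ∀ γ ∈ G, ∃ c : K, γ.1 *ᵥ v = c • v
  | .PSL => G.map ProjGenLinGroup.mk = (SpecialLinearGroup.toGL :
      SpecialLinearGroup (Fin 2) K →* GL (Fin 2) K).range.map ProjGenLinGroup.mk
  | .PGL => G.map ProjGenLinGroup.mk = ⊤

variable {G : Subgroup (GL (Fin 2) K)}

lemma eigenvalueProportion_eq_one_of_isOfType_B [Finite G] (h : IsOfType G .B) :
    eigenvalueProportion G = 1 := by
  obtain ⟨v, hv, hG⟩ := h
  refine proportion_eq_one_iff.2 fun γ => hasRationalEigenvalue_iff_exists_mulVec.2 ?_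
  obtain ⟨c, hc⟩ := hG γ γ.2
  exact ⟨c, v, hv, hc⟩

variable [Finite K] [NeZero (2 : K)]

lemma eigenvalueProportion_of_isOfType_PSL (h : IsOfType G .PSL) :
    eigenvalueProportion G = ((Nat.card K : ℚ) + 3) / (2 * ((Nat.card K : ℚ) + 1)) :=
  (eigenvalueProportion_eq_of_map_eq h).trans eigenvalueProportion_range_toGL

lemma eigenvalueProportion_of_isOfType_PGL (h : IsOfType G .PGL) :
    eigenvalueProportion G = ((Nat.card K : ℚ) + 2) / (2 * ((Nat.card K : ℚ) + 1)) := by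
  rw [← eigenvalueProportion_top]
  refine eigenvalueProportion_eq_of_map_eq (Eq.trans h ?_)
  exact (Subgroup.map_top_of_surjective _ ProjGenLinGroup.mk_surjective).symm

lemma eigenvalueProportion_ne_one_of_isOfType
    (h : IsOfType G .Cn ∨ IsOfType G .Nn ∨ IsOfType G .PSL ∨ IsOfType G .PGL) :
    eigenvalueProportion G ≠ 1 := by
  have one_lt_card : (1 : ℚ) < Nat.card K := by exact_mod_cast Finite.one_lt_card (α := K)
  rcases h with ⟨⟨D, hD, hG⟩, not_split⟩ | ⟨⟨D, hD, hG⟩, not_split⟩ | hPSL | hPGL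
  · exact mt (hD.exists_isSplit_of_eigenvalueProportion_eq_one
      (hG.trans cartan_le_cartanNormalizer)) not_split
  · exact mt (hD.exists_isSplit_of_eigenvalueProportion_eq_one hG) not_split
  · rw [eigenvalueProportion_of_isOfType_PSL hPSL, ne_eq, div_eq_one_iff_eq (by linarith)]
    linarith
  · rw [eigenvalueProportion_of_isOfType_PGL hPGL, ne_eq, div_eq_one_iff_eq (by linarith)]
    linarith

end Types

section Conjugation

variable {K : Type*} [Field K] {D : Matrix (Fin 2) (Fin 2) K}

lemma IsSplit.conj (hD : IsSplit D) (g : GL (Fin 2) K) : IsSplit (g⁻¹.1 * D * g.1) where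
  trace_eq_zero := by rw [trace_units_conj', hD.trace_eq_zero]
  det_ne_zero := by rw [det_units_conj']; exact hD.det_ne_zero
  isSquare_neg_det := by rw [det_units_conj']; exact hD.isSquare_neg_det

lemma IsNonsplit.conj (hD : IsNonsplit D) (g : GL (Fin 2) K) :
    IsNonsplit (g⁻¹.1 * D * g.1) where
  trace_eq_zero := by rw [trace_units_conj', hD.trace_eq_zero]
  not_isSquare_neg_det := by rw [det_units_conj']; exact hD.not_isSquare_neg_det

lemma semiconjBy_conj_iff {g γ : GL (Fin 2) K} {C : Matrix (Fin 2) (Fin 2) K} :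
    SemiconjBy (g * γ * g⁻¹).1 D C ↔ SemiconjBy γ.1 (g⁻¹.1 * D * g.1) (g⁻¹.1 * C * g.1) := by
  rw [SemiconjBy, SemiconjBy, ← Units.mul_right_inj g⁻¹, ← Units.mul_left_inj g]
  simp only [Units.val_mul, mul_assoc, Units.inv_mul_cancel_left, Units.inv_mul, mul_one]

lemma isNonsplit_companion {ε : K} (hε : ¬ IsSquare ε) : IsNonsplit !![0, ε; 1, 0] where
  trace_eq_zero := by simp [trace_fin_two]
  not_isSquare_neg_det := by simpa [det_fin_two] using hε

lemma IsSplit.exists_conj_diag_eq [NeZero (2 : K)] (hD : IsSplit D) :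
    ∃ (g : GL (Fin 2) K) (s : K), s ≠ 0 ∧ g⁻¹.1 * (s • !![1, 0; 0, -1]) * g.1 = D := by
  have h11 : D 1 1 = -D 0 0 := (neg_eq_of_add_eq_zero_right
    ((trace_fin_two D).symm.trans hD.trace_eq_zero)).symm
  -- The sign of `s` has to be chosen such that the intertwiner `D + s • E` below is invertible.
  obtain ⟨s, hs, apply_add_ne_zero⟩ : ∃ s, -D.det = s * s ∧ D 0 0 + s ≠ 0 := by
    obtain ⟨s, hs⟩ := hD.isSquare_neg_det
    by_cases h : D 0 0 + s = 0
    · refine ⟨-s, by rw [hs, neg_mul_neg], fun h' => hD.det_ne_zero ?_⟩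
      have : s = 0 := by
        refine (mul_eq_zero.1 (?_ : 2 * s = 0)).resolve_left two_ne_zero
        linear_combination h - h'
      rw [← neg_eq_zero, hs, this, mul_zero]
    · exact ⟨s, hs, h⟩
  have s_ne_zero : s ≠ 0 := fun h => hD.det_ne_zero (by rw [← neg_eq_zero, hs, h, mul_zero])
  let E : Matrix (Fin 2) (Fin 2) K := !![1, 0; 0, -1]
  have det_eq : (D + s • E).det = -(2 * s * (D 0 0 + s)) := by
    have sq_eq : D 0 0 * D 0 0 + D 0 1 * D 1 0 = s * s := by
      rw [← hs, det_fin_two, h11]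
      ring
    rw [det_fin_two]
    simp only [E, Matrix.add_apply, Matrix.smul_apply, of_apply, cons_val', cons_val_zero,
      cons_val_one, cons_val_fin_one, smul_eq_mul, mul_one, mul_zero, mul_neg, add_zero, h11]
    linear_combination -sq_eq
  let P := GeneralLinearGroup.mkOfDetNeZero (D + s • E) (by
    rw [det_eq, neg_ne_zero]
    exact mul_ne_zero (mul_ne_zero two_ne_zero s_ne_zero) apply_add_ne_zero)
  have mul_P : D * P.1 = P.1 * (s • E) := by
    have E_mul_self : E * E = 1 := by simp [E, one_fin_two]
    change D * (D + s • E) = (D + s • E) * (s • E)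
    rw [mul_add, add_mul, mul_self_of_trace_eq_zero hD.trace_eq_zero, hs, smul_mul_smul_comm,
      E_mul_self, add_comm]
  refine ⟨P⁻¹, s, s_ne_zero, ?_⟩
  rw [inv_inv, ← mul_P, mul_assoc, Units.mul_inv, mul_one]

lemma eq_diag_of_commute_smul_diag [NeZero (2 : K)] {s : K} (hs : s ≠ 0)
    (h : Commute D (s • !![1, 0; 0, -1])) : D = !![D 0 0, 0; 0, D 1 1] := by
  have two_mul_ne_zero : 2 * s ≠ 0 := mul_ne_zero two_ne_zero hs
  have h01 : -(D 0 1 * s) = s * D 0 1 := by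
    simpa [mul_apply, Fin.sum_univ_two] using congrFun₂ h.eq 0 1
  have h10 : D 1 0 * s = -(s * D 1 0) := by
    simpa [mul_apply, Fin.sum_univ_two] using congrFun₂ h.eq 1 0
  have apply_zero_one : D 0 1 = 0 :=
    (mul_eq_zero.1 (by linear_combination -h01)).resolve_left two_mul_ne_zero
  have apply_one_zero : D 1 0 = 0 :=
    (mul_eq_zero.1 (by linear_combination h10)).resolve_left two_mul_ne_zero
  conv_lhs => rw [eta_fin_two D, apply_zero_one, apply_one_zero]

end Conjugation

section DicksonTypes

variable {ℓ : ℕ} {G : Subgroup (GL2 ℓ)}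

lemma eigenProportion_eq_eigenvalueProportion [Fact ℓ.Prime] :
    eigenProportion G = eigenvalueProportion G := by
  rw [eigenProportion, eigenvalueProportion, proportion]
  congr 2
  exact (Nat.card_congr (Equiv.subtypeSubtypeEquivSubtypeInter (· ∈ G)
    fun γ => HasRationalEigenvalue γ.1)).symm

variable [Fact ℓ.Prime] {D : Matrix (Fin 2) (Fin 2) (ZMod ℓ)} {S : Set (GL2 ℓ)}

lemma splitCartan_subset_cartan :
    splitCartan ℓ ⊆ cartan (!![1, 0; 0, -1] : Matrix (Fin 2) (Fin 2) (ZMod ℓ)) := by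
  rintro γ ⟨a, b, hγ⟩
  rw [SetLike.mem_coe, mem_cartan, hγ]
  ext i j
  fin_cases i <;> fin_cases j <;> simp

lemma nonsplitCartan_subset_cartan (ε : ZMod ℓ) : nonsplitCartan ℓ ε ⊆ cartan !![0, ε; 1, 0] := by
  rintro γ ⟨a, b, hγ⟩
  rw [SetLike.mem_coe, mem_cartan, hγ]
  ext i j
  fin_cases i <;> fin_cases j <;> simp [mul_comm]

lemma splitCartanNormalizer_subset_cartanNormalizer :
    splitCartanNormalizer ℓ ⊆
      cartanNormalizer (!![1, 0; 0, -1] : Matrix (Fin 2) (Fin 2) (ZMod ℓ)) := by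
  rintro γ (hγ | ⟨δ, ⟨a, b, hδ⟩, hγ⟩)
  · exact cartan_le_cartanNormalizer (splitCartan_subset_cartan hγ)
  · refine ⟨-1, ?_⟩
    rw [SemiconjBy, hγ, hδ]
    ext i j
    fin_cases i <;> fin_cases j <;> simp [Units.smul_def]

lemma nonsplitCartanNormalizer_subset_cartanNormalizer (ε : ZMod ℓ) :
    nonsplitCartanNormalizer ℓ ε ⊆ cartanNormalizer !![0, ε; 1, 0] := by
  rintro γ (hγ | ⟨δ, ⟨a, b, hδ⟩, hγ⟩)
  · exact cartan_le_cartanNormalizer (nonsplitCartan_subset_cartan ε hγ)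
  · refine ⟨-1, ?_⟩
    rw [SemiconjBy, hγ, hδ]
    ext i j
    fin_cases i <;> fin_cases j <;> simp [Units.smul_def, mul_comm]

lemma ConjInto.exists_le_cartan (h : ConjInto G S) (hS : S ⊆ cartan D) :
    ∃ g : GL2 ℓ, G ≤ cartan (g⁻¹.1 * D * g.1) := by
  obtain ⟨g, hg⟩ := h
  exact ⟨g, fun γ hγ => semiconjBy_conj_iff.1 (hS (hg γ hγ))⟩

lemma ConjInto.exists_le_cartanNormalizer (h : ConjInto G S) (hS : S ⊆ cartanNormalizer D) :
    ∃ g : GL2 ℓ, G ≤ cartanNormalizer (g⁻¹.1 * D * g.1) := by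
  obtain ⟨g, hg⟩ := h
  refine ⟨g, fun γ hγ => ?_⟩
  obtain ⟨s, hs⟩ := hS (hg γ hγ)
  refine ⟨s, ?_⟩
  simpa only [mul_smul_comm, smul_mul_assoc] using semiconjBy_conj_iff.1 hs

lemma ConjInto.exists_common_eigenvector (h : ConjInto G (borel ℓ)) :
    ∃ v : Fin 2 → ZMod ℓ, v ≠ 0 ∧ ∀ γ ∈ G, ∃ c : ZMod ℓ, γ.1 *ᵥ v = c • v := by
  obtain ⟨g, hg⟩ := h
  refine ⟨g⁻¹.1 *ᵥ ![1, 0], fun h => ?_, fun γ hγ => ?_⟩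
  · have : ![1, 0] = (0 : Fin 2 → ZMod ℓ) := by
      simpa only [mulVec_mulVec, Units.mul_inv, one_mulVec, mulVec_zero] using congrArg (g.1 *ᵥ ·) h
    exact one_ne_zero (congrFun this 0)
  · obtain ⟨a, b, d, h⟩ := hg γ hγ
    have conj_mulVec : (g * γ * g⁻¹).1 *ᵥ ![1, 0] = a • ![1, 0] := by
      rw [h]
      ext i
      fin_cases i <;> simp
    refine ⟨a, ?_⟩
    rw [← mulVec_smul, ← conj_mulVec]
    simp only [Units.val_mul, mulVec_mulVec, mul_assoc, Units.inv_mul_cancel_left]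

lemma conjInto_splitCartan_of_le_cartan [NeZero (2 : ZMod ℓ)] (hD : IsSplit D)
    (hG : G ≤ cartan D) : ConjInto G (splitCartan ℓ) := by
  obtain ⟨g, s, hs, rfl⟩ := hD.exists_conj_diag_eq
  refine ⟨g, fun γ hγ => ?_⟩
  exact ⟨_, _, eq_diag_of_commute_smul_diag hs (semiconjBy_conj_iff.2 (hG hγ))⟩

lemma HasType.isOfType [NeZero (2 : ZMod ℓ)] {ε : ZMod ℓ} (hε : ¬ IsSquare ε) {t : DicksonType}
    (h : HasType ε G t) : IsOfType G t := by
  have not_split (h : ¬ ConjInto G (splitCartan ℓ)) : ¬ ∃ D, IsSplit D ∧ G ≤ cartan D :=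
    fun ⟨_, hD, hG⟩ => h (conjInto_splitCartan_of_le_cartan hD hG)
  cases t with
  | Cs =>
    obtain ⟨g, hg⟩ := h.2.exists_le_cartan splitCartan_subset_cartan
    exact ⟨_, isSplit_diag.conj g, hg⟩
  | Cn =>
    obtain ⟨g, hg⟩ := h.2.1.exists_le_cartan (nonsplitCartan_subset_cartan ε)
    exact ⟨⟨_, (isNonsplit_companion hε).conj g, hg⟩, not_split h.2.2⟩
  | Ns =>
    obtain ⟨g, hg⟩ :=
      h.2.1.exists_le_cartanNormalizer splitCartanNormalizer_subset_cartanNormalizer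
    exact ⟨_, isSplit_diag.conj g, hg⟩
  | Nn =>
    obtain ⟨g, hg⟩ :=
      h.2.1.exists_le_cartanNormalizer (nonsplitCartanNormalizer_subset_cartanNormalizer ε)
    refine ⟨⟨_, (isNonsplit_companion hε).conj g, hg⟩, not_split ?_⟩
    exact fun ⟨g, hg⟩ => h.2.2.1 ⟨g, fun γ hγ => .inl (hg γ hγ)⟩
  | B => exact h.2.1.exists_common_eigenvector
  | A4 | S4 | A5 | PSL | PGL => exact h.2

end DicksonTypes

end EigenProportion

theorem mainTheorem3_general {K : Type*} [Field K] [Finite K] [NeZero (2 : K)]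
    (G : Subgroup (Matrix.GeneralLinearGroup (Fin 2) K)) :
    (IsOfType G .Cs ∨ IsOfType G .B → eigenvalueProportion G = 1) ∧
    (IsOfType G .Cn → eigenvalueProportion G =
      1 / (Nat.card (G.map Matrix.ProjGenLinGroup.mk) : ℚ)) ∧
    (IsOfType G .PSL → eigenvalueProportion G =
      ((Nat.card K : ℚ) + 3) / (2 * ((Nat.card K : ℚ) + 1))) ∧
    (IsOfType G .PGL → eigenvalueProportion G =
      ((Nat.card K : ℚ) + 2) / (2 * ((Nat.card K : ℚ) + 1))) ∧
    (IsOfType G .Ns → eigenvalueProportion G ∈ ({1 / 2, 3 / 4, 1} : Set ℚ)) ∧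
    (IsOfType G .Nn → eigenvalueProportion G ∈
      ({1 / (Nat.card (G.map Matrix.ProjGenLinGroup.mk) : ℚ),
        1 / 4 + 1 / (Nat.card (G.map Matrix.ProjGenLinGroup.mk) : ℚ),
        1 / 2 + 1 / (Nat.card (G.map Matrix.ProjGenLinGroup.mk) : ℚ)} : Set ℚ)) ∧
    (IsOfType G .A4 → eigenvalueProportion G ∈ ({1 / 12, 1 / 3, 3 / 4, 1} : Set ℚ)) ∧
    (IsOfType G .S4 → eigenvalueProportion G ∈
      ({1 / 24, 7 / 24, 3 / 8, 5 / 12, 5 / 8, 2 / 3, 3 / 4, 1} : Set ℚ)) ∧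
    (IsOfType G .A5 → eigenvalueProportion G ∈
      ({1 / 60, 4 / 15, 7 / 20, 5 / 12, 3 / 5, 2 / 3, 3 / 4, 1} : Set ℚ)) ∧
    (IsOfType G .Cn ∨ IsOfType G .Nn ∨ IsOfType G .PSL ∨ IsOfType G .PGL →
      eigenvalueProportion G ≤ 3 / 4) ∧
    (eigenvalueProportion G ≠ 1 → eigenvalueProportion G ≤ 3 / 4) := by
  refine ⟨?_, ?_, eigenvalueProportion_of_isOfType_PSL, eigenvalueProportion_of_isOfType_PGL,
    ?_, ?_, ?_, ?_, ?_, fun h => eigenvalueProportion_le_of_ne_one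
      (eigenvalueProportion_ne_one_of_isOfType h), eigenvalueProportion_le_of_ne_one⟩
  · rintro (⟨D, hD, hG⟩ | hB)
    exacts [hD.eigenvalueProportion_of_le_cartan hG, eigenvalueProportion_eq_one_of_isOfType_B hB]
  · exact fun ⟨⟨D, hD, hG⟩, _⟩ => hD.eigenvalueProportion_of_le_cartan hG
  · exact fun ⟨D, hD, hG⟩ => hD.eigenvalueProportion_mem_of_le_cartanNormalizer hG
  · exact fun ⟨⟨D, hD, hG⟩, _⟩ => hD.eigenvalueProportion_mem_of_le_cartanNormalizer hG
  · rintro ⟨e⟩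
    obtain ⟨E, hE, h⟩ := exists_isFixingLike_eigenvalueProportion_eq e
    exact h ▸ hE.proportion_mem_of_alternatingGroup_four
  · rintro ⟨e⟩
    obtain ⟨E, hE, h⟩ := exists_isFixingLike_eigenvalueProportion_eq e
    exact h ▸ hE.proportion_mem_of_perm_four
  · rintro ⟨e⟩
    obtain ⟨E, hE, h⟩ := exists_isFixingLike_eigenvalueProportion_eq e
    exact h ▸ hE.proportion_mem_of_alternatingGroup_five

theorem mainTheorem3 (ℓ : ℕ) [Fact ℓ.Prime] (hℓ : ℓ ≠ 2) (ε : ZMod ℓ) (hε : ¬ IsSquare ε)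
    (G : Subgroup (GL2 ℓ)) :
    (HasType ε G .Cs ∨ HasType ε G .B → eigenProportion G = 1) ∧
    (HasType ε G .Cn → eigenProportion G = 1 / (Nat.card (projImage G) : ℚ)) ∧
    (HasType ε G .PSL → eigenProportion G = ((ℓ : ℚ) + 3) / (2 * ((ℓ : ℚ) + 1))) ∧
    (HasType ε G .PGL → eigenProportion G = ((ℓ : ℚ) + 2) / (2 * ((ℓ : ℚ) + 1))) ∧
    (HasType ε G .Ns → eigenProportion G ∈ ({1 / 2, 3 / 4, 1} : Set ℚ)) ∧
    (HasType ε G .Nn → eigenProportion G ∈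
      ({1 / (Nat.card (projImage G) : ℚ), 1 / 4 + 1 / (Nat.card (projImage G) : ℚ),
        1 / 2 + 1 / (Nat.card (projImage G) : ℚ)} : Set ℚ)) ∧
    (HasType ε G .A4 → eigenProportion G ∈ ({1 / 12, 1 / 3, 3 / 4, 1} : Set ℚ)) ∧
    (HasType ε G .S4 → eigenProportion G ∈
      ({1 / 24, 7 / 24, 3 / 8, 5 / 12, 5 / 8, 2 / 3, 3 / 4, 1} : Set ℚ)) ∧
    (HasType ε G .A5 → eigenProportion G ∈
      ({1 / 60, 4 / 15, 7 / 20, 5 / 12, 3 / 5, 2 / 3, 3 / 4, 1} : Set ℚ)) ∧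
    (HasType ε G .Cn ∨ HasType ε G .Nn ∨ HasType ε G .PSL ∨ HasType ε G .PGL →
      eigenProportion G ≤ 3 / 4) ∧
    (eigenProportion G ≠ 1 → eigenProportion G ≤ 3 / 4) := by
  have : NeZero (2 : ZMod ℓ) := ⟨Ring.two_ne_zero (by rwa [ZMod.ringChar_zmod_n])⟩
  have type {t} : HasType ε G t → IsOfType G t := HasType.isOfType hε
  obtain ⟨split_borel, Cn, PSL, PGL, Ns, Nn, A4, S4, A5, bound, gap⟩ := mainTheorem3_general G
  simp only [← eigenProportion_eq_eigenvalueProportion, Nat.card_zmod] at *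
  exact ⟨fun h => split_borel (h.imp type type), fun h => Cn (type h), fun h => PSL (type h),
    fun h => PGL (type h), fun h => Ns (type h), fun h => Nn (type h), fun h => A4 (type h),
    fun h => S4 (type h), fun h => A5 (type h),
    fun h => bound (h.imp type (.imp type (.imp type type))), gap⟩
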